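/- Let $n\ge 3$ and let $\mathrm{C}_n$ be the $n$-cycle. At time $0$ there is exactly one walker at each vertex of $\mathrm{C}_n$, and the walkers perform independent continuous-time simple random walks on $\mathrm{C}_n$ with jump rate $1$ (each walker waits independent exponential times of rate $1$ between jumps and at each jump moves to one of the two neighbouring vertices with probability $1/2$ each). Two walkers have met by time $t$ if they are at the same vertex at some time $t_0\le t$; two walkers $a,b$ have a path of acquaintances by time $t$ if there are walkers $a=c_0,c_1,\dots,c_{k+1}=b$ such that $c_i$ and $c_{i+1}$ have met by time $t$ for all $0\le i\le k$. The social connectivity time $\mathrm{SC}(\mathrm{C}_n)$ is the first time $t$ by which every two walkers have a path of acquaintances. Then there exist absolute constants $c_1,c_2,\alpha,C_1,C_2>0$ such that for every $n\ge 3$ $$\Pr[\mathrm{SC}(\mathrm{C}_n)>C_1(\log n)^2]\le \frac{C_2}{n}\qquad\text{and}\qquad \Pr[\mathrm{SC}(\mathrm{C}_n)<c_1(\log n)^2]\le e^{-c_2n^{\alpha}}.$$ -/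

import Mathlib

open MeasureTheory ProbabilityTheory
open scoped NNReal ENNReal

namespace SocialNetwork

section Acquaintances

variable {W V : Type*}

/-- Two walkers have met by time `t`: they occupy the same vertex at some time `t₀ ≤ t`.
Here `X w t` is the position of the walker `w` at time `t`. -/
def MetBy (X : W → ℝ≥0 → V) (t : ℝ≥0) (w w' : W) : Prop :=
  ∃ t₀ : ℝ≥0, t₀ ≤ t ∧ X w t₀ = X w' t₀

/-- Two walkers `a`, `b` have a path of acquaintances by time `t`: there are walkers
`a = c₀, c₁, …, cₖ, cₖ₊₁ = b` such that `cᵢ` and `cᵢ₊₁` have met by time `t` for all `i ≤ k`. -/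
def HavePathBy (X : W → ℝ≥0 → V) (t : ℝ≥0) (a b : W) : Prop :=
  Relation.TransGen (MetBy X t) a b

/-- The social connectivity time: the first time by which every two walkers have a path of
acquaintances (it is `∞` if there is no such time). -/
noncomputable def socialConnectivityTime (X : W → ℝ≥0 → V) : ℝ≥0∞ :=
  ⨅ (t : ℝ≥0) (_ : ∀ a b : W, HavePathBy X t a b), (t : ℝ≥0∞)

end Acquaintances

section Walks

/-- The law of one step of simple random walk: `+1` or `-1`, with probability `1/2` each. -/
noncomputable def stepLaw : Measure ℤ :=
  (2⁻¹ : ℝ≥0∞) • (Measure.dirac 1 + Measure.dirac (-1))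

/-- The number of jumps made up to time `t` (inclusive), where `hold k` is the waiting time
before the jump number `k` (counted from `0`). -/
noncomputable def jumpCount (hold : ℕ → ℝ) (t : ℝ≥0) : ℕ :=
  Set.ncard {k : ℕ | ∑ i ∈ Finset.range (k + 1), hold i ≤ (t : ℝ)}

/-- The position at time `t` of a walker on the `n`-cycle `ZMod n` (with edges `{x, x + 1}`)
that starts at `x`, waits the times `hold 0, hold 1, …` between its jumps, and moves by `step k`
in the jump number `k`. -/
noncomputable def position {n : ℕ} (x : ZMod n) (hold : ℕ → ℝ) (step : ℕ → ℤ) (t : ℝ≥0) :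
    ZMod n :=
  x + ((∑ i ∈ Finset.range (jumpCount hold t), step i : ℤ) : ZMod n)

/-- The random input of independent continuous-time simple random walks with jump rate `1`, one for
each vertex of the `n`-cycle: `hold w k` is the waiting time of the walker `w` before its jump
number `k` and `step w k` is the displacement in that jump. All waiting times are exponential of
rate `1`, all steps are uniform in `{1, -1}`, and all these variables are independent. -/
structure IsWalkInput {Ω : Type*} [MeasurableSpace Ω] (μ : Measure Ω) (n : ℕ)
    (hold : ZMod n → ℕ → Ω → ℝ) (step : ZMod n → ℕ → Ω → ℤ) : Prop where
  hasLaw : ∀ (w : ZMod n) (k : ℕ),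
    HasLaw (fun ω => (hold w k ω, step w k ω)) ((expMeasure 1).prod stepLaw) μ
  indep : iIndepFun (fun (p : ZMod n × ℕ) (ω : Ω) => (hold p.1 p.2 ω, step p.1 p.2 ω)) μ

/-- The trajectories of the walkers: there is one walker `w` for each vertex `w`, and it starts
there. -/
noncomputable def trajectory {Ω : Type*} {n : ℕ} (hold : ZMod n → ℕ → Ω → ℝ)
    (step : ZMod n → ℕ → Ω → ℤ) (ω : Ω) : ZMod n → ℝ≥0 → ZMod n :=
  fun w t => position w (fun k => hold w k ω) (fun k => step w k ω) t

/-- The social connectivity time of the walkers on the `n`-cycle, as a random variable. -/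
noncomputable def cycleSC {Ω : Type*} {n : ℕ} (hold : ZMod n → ℕ → Ω → ℝ)
    (step : ZMod n → ℕ → Ω → ℤ) (ω : Ω) : ℝ≥0∞ :=
  socialConnectivityTime (trajectory hold step ω)

end Walks

end SocialNetwork

/-!
The law of the inputs of all walkers is a product measure `walkersLaw n`, so it is enough to work
with that measure. The proof rests on the order of the walkers on the universal cover `ℤ` of the
cycle: almost surely no two walkers jump at the same time, hence two walkers cannot change order
without meeting (`exists_meeting_time`), and the groups of acquainted walkers are arcs.

*Upper bound.* Fix an edge `{x, x + 1}`, a time `t` and an integer `L` of order `√t`. Each of the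
`L` nearest walkers on the left ends up at distance at least `L` to the right of its starting point
with probability bounded below (`walkerLaw_farRight`): it makes enough jumps, and the second moment
method applies to the square of simple random walk. So does each of the `L` nearest walkers on the
right, with left and right exchanged. Outside an event of probability exponentially small in `L`
there is then a walker that crosses the edge from the left, and one that crosses it from the right;
those two have met, and every walker that started between them has met one of them
(`Typical.connectedBy`). For `L` of order `log n` the exceptional events are negligible, even when
summed over all edges.

*Lower bound.* An edge is a `barrier` if each of the `2 * m` walkers nearest to it stays on its own
side. The probability that a walker at distance `i` from the edge does so for `L ^ 2` jumps is at
least of order `i / L` when `i` is at most `2 * L`, because `sin (π x / M)` is an eigenfunction of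
the walk killed at `0` and `M`, and it is exponentially close to `1` beyond, because `exp (-θ x)` is
an eigenfunction of the free walk. By Stirling's formula the product over all walkers is at least
`exp (-8 * L) / 4`, for every `m` that is not too large for all walkers to be likely to make at most
`L ^ 2` jumps (`exp_le_prod_staysBelow`). For `L` a small multiple of `log n` this exceeds a small
negative power of `n`, while the cycle contains on the order of `√n` disjoint neighbourhoods of
radius `m` of order `√n`, on which the barriers are independent. Hence there are two barriers, except
with probability `exp (-n ^ α)`. As it is also very unlikely that a walker makes `m` jumps, two
barriers separate the walkers into two arcs that never meet (`Typical.not_connectedBy`). For small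
`n` it suffices that with positive probability nobody moves.
-/

namespace SocialNetwork

/-! ### The law of the random input -/

instance isProbabilityMeasure_expMeasure_one : IsProbabilityMeasure (expMeasure 1) :=
  isProbabilityMeasure_expMeasure one_pos

instance isProbabilityMeasure_stepLaw : IsProbabilityMeasure stepLaw := by
  constructor
  simp [stepLaw, ENNReal.inv_two_add_inv_two]

/-- The law of the waiting times of one walker. -/
noncomputable def holdLaw : Measure (ℕ → ℝ) := Measure.infinitePi fun _ => expMeasure 1

/-- The law of the steps of one walker. -/
noncomputable def stepsLaw : Measure (ℕ → ℤ) := Measure.infinitePi fun _ => stepLaw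

instance : IsProbabilityMeasure holdLaw := by unfold holdLaw; infer_instance
instance : IsProbabilityMeasure stepsLaw := by unfold stepsLaw; infer_instance

/-- The law of the whole random input of one walker: its waiting times and its steps, as two
independent sequences. -/
noncomputable def walkerLaw : Measure ((ℕ → ℝ) × (ℕ → ℤ)) := holdLaw.prod stepsLaw

instance : IsProbabilityMeasure walkerLaw := by unfold walkerLaw; infer_instance

/-- The law of the inputs of all walkers. -/
noncomputable def walkersLaw (n : ℕ) : Measure (ZMod n → (ℕ → ℝ) × (ℕ → ℤ)) :=
  Measure.infinitePi fun _ => walkerLaw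

instance (n : ℕ) : IsProbabilityMeasure (walkersLaw n) := by unfold walkersLaw; infer_instance

/-- An independent sequence of independent pairs is the same as two independent sequences. -/
lemma infinitePi_prod_map_unzip {X Y : Type*} [MeasurableSpace X] [MeasurableSpace Y]
    (μ : Measure X) (ν : Measure Y) [IsProbabilityMeasure μ] [IsProbabilityMeasure ν] :
    (Measure.infinitePi fun _ : ℕ => μ.prod ν).map
      (fun x => ((fun k => (x k).1, fun k => (x k).2) : (ℕ → X) × (ℕ → Y))) =
    (Measure.infinitePi fun _ : ℕ => μ).prod (Measure.infinitePi fun _ : ℕ => ν) := by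
  set P := (Measure.infinitePi fun _ : ℕ => μ).prod (Measure.infinitePi fun _ : ℕ => ν)
  have hm : ∀ k : ℕ, Measurable fun x : (ℕ → X) × (ℕ → Y) => (x.1 k, x.2 k) := by
    intro k; fun_prop
  -- The pairs of coordinates are independent: rectangles form a π-system.
  have hind : iIndepFun (fun (k : ℕ) (x : (ℕ → X) × (ℕ → Y)) => (x.1 k, x.2 k)) P := by
    rw [iIndepFun_iff_iIndep]
    refine iIndepSets.iIndep (fun k => (hm k).comap_le)
      (fun k => {s | ∃ (A : Set X) (B : Set Y), MeasurableSet A ∧ MeasurableSet B ∧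
        s = (fun x : (ℕ → X) × (ℕ → Y) => (x.1 k, x.2 k)) ⁻¹' (A ×ˢ B)}) ?_ ?_ ?_
    · rintro k _ ⟨A, B, hA, hB, rfl⟩ _ ⟨A', B', hA', hB', rfl⟩ _
      exact ⟨A ∩ A', B ∩ B', hA.inter hA', hB.inter hB', by
        rw [← Set.preimage_inter, Set.prod_inter_prod]⟩
    · intro k
      rw [← generateFrom_prod, MeasurableSpace.comap_generateFrom]
      congr 1
      ext s
      simp only [Set.mem_image, Set.mem_image2, Set.mem_ofPred_eq]
      constructor
      · rintro ⟨_, ⟨A, hA, B, hB, rfl⟩, rfl⟩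
        exact ⟨A, B, hA, hB, rfl⟩
      · rintro ⟨A, B, hA, hB, rfl⟩
        exact ⟨_, ⟨A, hA, B, hB, rfl⟩, rfl⟩
    · rw [iIndepSets_iff]
      intro s f hf
      choose! A B hA hB hAB using hf
      have h1 : (⋂ i ∈ s, f i) = (Set.pi s A) ×ˢ (Set.pi s B) := by
        ext x
        simp only [Set.mem_iInter, Set.mem_prod, Set.mem_pi, Finset.mem_coe]
        constructor
        · intro h
          have h' : ∀ i ∈ s, x.1 i ∈ A i ∧ x.2 i ∈ B i := by
            intro i hi
            have := h i hi
            rw [hAB i hi] at this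
            exact this
          exact ⟨fun i hi => (h' i hi).1, fun i hi => (h' i hi).2⟩
        · rintro ⟨h1, h2⟩ i hi
          rw [hAB i hi]
          exact ⟨h1 i hi, h2 i hi⟩
      rw [h1, Measure.prod_prod, Measure.infinitePi_pi _ hA, Measure.infinitePi_pi _ hB,
        ← Finset.prod_mul_distrib]
      refine Finset.prod_congr rfl fun i hi => ?_
      have h2 : f i = ((fun x : ℕ → X => x i) ⁻¹' A i) ×ˢ ((fun x : ℕ → Y => x i) ⁻¹' B i) := by
        rw [hAB i hi]; rfl
      rw [h2, Measure.prod_prod,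
        (measurePreserving_eval_infinitePi (fun _ => μ) i).measure_preimage
          (hA i hi).nullMeasurableSet,
        (measurePreserving_eval_infinitePi (fun _ => ν) i).measure_preimage
          (hB i hi).nullMeasurableSet]
  have hlaw : ∀ k : ℕ, HasLaw (fun x : (ℕ → X) × (ℕ → Y) => (x.1 k, x.2 k)) (μ.prod ν) P := by
    intro k
    exact ((measurePreserving_eval_infinitePi (fun _ => μ) k).prod
      (measurePreserving_eval_infinitePi (fun _ => ν) k)).hasLaw
  have h := (hind.hasLaw_infinitePi hlaw (by fun_prop)).map_eq
  rw [← h, Measure.map_map (by fun_prop) (by fun_prop)]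
  exact Measure.map_id

/-- The joint law of the inputs of all walkers, whatever the underlying probability space. -/
lemma IsWalkInput.hasLaw_walkersLaw {Ω : Type*} [MeasurableSpace Ω] {μ : Measure Ω} {n : ℕ}
    {hold : ZMod n → ℕ → Ω → ℝ} {step : ZMod n → ℕ → Ω → ℤ} (h : IsWalkInput μ n hold step) :
    HasLaw (fun ω (w : ZMod n) => ((fun k => hold w k ω, fun k => step w k ω) :
      (ℕ → ℝ) × (ℕ → ℤ))) (walkersLaw n) μ := by
  have : Countable (ZMod n) := by
    cases n
    · exact inferInstanceAs (Countable ℤ)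
    · exact inferInstanceAs (Countable (Fin _))
  have h1 := h.indep.hasLaw_infinitePi (fun p : ZMod n × ℕ => h.hasLaw p.1 p.2)
    (aemeasurable_pi_lambda _ fun p : ZMod n × ℕ => (h.hasLaw p.1 p.2).aemeasurable)
  have h2 : HasLaw (MeasurableEquiv.curry (ZMod n) ℕ (ℝ × ℤ))
      (Measure.infinitePi fun _ : ZMod n => Measure.infinitePi fun _ : ℕ =>
        (expMeasure 1).prod stepLaw)
      (Measure.infinitePi fun _ : ZMod n × ℕ => (expMeasure 1).prod stepLaw) :=
    ⟨(MeasurableEquiv.measurable _).aemeasurable,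
      Measure.infinitePi_map_curry (fun _ _ => (expMeasure 1).prod stepLaw)⟩
  have h3 : HasLaw (fun (x : ZMod n → ℕ → ℝ × ℤ) (w : ZMod n) =>
      ((fun k => (x w k).1, fun k => (x w k).2) : (ℕ → ℝ) × (ℕ → ℤ))) (walkersLaw n)
      (Measure.infinitePi fun _ : ZMod n => Measure.infinitePi fun _ : ℕ =>
        (expMeasure 1).prod stepLaw) := by
    refine ⟨by fun_prop, ?_⟩
    rw [Measure.infinitePi_map_pi (X := fun _ : ZMod n => ℕ → ℝ × ℤ)
      (μ := fun _ => Measure.infinitePi fun _ : ℕ => (expMeasure 1).prod stepLaw)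
      (f := fun _ y => ((fun k => (y k).1, fun k => (y k).2) : (ℕ → ℝ) × (ℕ → ℤ)))
      (by fun_prop)]
    simp only [infinitePi_prod_map_unzip]
    rfl
  exact h3.comp (h2.comp h1)

/-! ### Exponential waiting times -/

/-- The time of the jump number `k`, where the jumps are counted from `1` and `jumpTime h 0 = 0`. -/
def jumpTime (h : ℕ → ℝ) (k : ℕ) : ℝ := ∑ i ∈ Finset.range k, h i

@[simp] lemma jumpTime_zero (h : ℕ → ℝ) : jumpTime h 0 = 0 := by simp [jumpTime]

lemma jumpTime_succ (h : ℕ → ℝ) (k : ℕ) : jumpTime h (k + 1) = jumpTime h k + h k := by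
  simp [jumpTime, Finset.sum_range_succ]

@[fun_prop] lemma measurable_jumpTime (k : ℕ) : Measurable fun h : ℕ → ℝ => jumpTime h k := by
  unfold jumpTime; fun_prop

lemma lintegral_exp_mul_expMeasure {θ : ℝ} (hθ : θ < 1) :
    ∫⁻ x, ENNReal.ofReal (Real.exp (θ * x)) ∂expMeasure 1 = ENNReal.ofReal (1 / (1 - θ)) := by
  have h1 : (0 : ℝ) < 1 - θ := by linarith
  have hm : ∀ r, Measurable (gammaPDF 1 r) := fun r =>
    (measurable_gammaPDFReal 1 r).ennreal_ofReal
  rw [expMeasure, gammaMeasure, lintegral_withDensity_eq_lintegral_mul _ (hm 1) (by fun_prop)]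
  have h2 : ∀ x, (gammaPDF 1 1 * fun x => ENNReal.ofReal (Real.exp (θ * x))) x =
      ENNReal.ofReal (1 / (1 - θ)) * gammaPDF 1 (1 - θ) x := by
    intro x
    change exponentialPDF 1 x * _ = _ * exponentialPDF (1 - θ) x
    rcases lt_or_ge x 0 with hx | hx
    · rw [exponentialPDF_of_neg hx, exponentialPDF_of_neg hx]; simp
    · rw [exponentialPDF_of_nonneg hx, exponentialPDF_of_nonneg hx,
        ← ENNReal.ofReal_mul (by positivity), ← ENNReal.ofReal_mul (by positivity)]
      congr 1
      rw [← mul_assoc, one_div_mul_cancel h1.ne', one_mul, one_mul, ← Real.exp_add]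
      ring_nf
  rw [lintegral_congr h2, lintegral_const_mul _ (hm _), lintegral_gammaPDF_eq_one one_pos h1,
    mul_one]

lemma iIndepFun_eval_holdLaw : iIndepFun (fun (k : ℕ) (h : ℕ → ℝ) => h k) holdLaw :=
  iIndepFun_infinitePi (X := fun _ x => x) (by fun_prop)

lemma lintegral_exp_jumpTime {θ : ℝ} (hθ : θ < 1) (k : ℕ) :
    ∫⁻ h, ENNReal.ofReal (Real.exp (θ * jumpTime h k)) ∂holdLaw =
      ENNReal.ofReal (1 / (1 - θ)) ^ k := by
  have h1 : ∀ h : ℕ → ℝ, ENNReal.ofReal (Real.exp (θ * jumpTime h k)) =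
      ∏ i ∈ Finset.range k, ENNReal.ofReal (Real.exp (θ * h i)) := by
    intro h
    rw [jumpTime, Finset.mul_sum, Real.exp_sum, ENNReal.ofReal_prod_of_nonneg]
    intro i _; positivity
  have h2 : ∀ i : ℕ, ∫⁻ h, ENNReal.ofReal (Real.exp (θ * h i)) ∂holdLaw =
      ENNReal.ofReal (1 / (1 - θ)) := by
    intro i
    rw [← lintegral_exp_mul_expMeasure hθ]
    exact (measurePreserving_eval_infinitePi (fun _ : ℕ => expMeasure 1) i).lintegral_comp
      (f := fun x => ENNReal.ofReal (Real.exp (θ * x))) (by fun_prop)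
  rw [lintegral_congr h1, lintegral_prod_eq_prod_lintegral_of_indepFun (Finset.range k)
    (fun (i : ℕ) (h : ℕ → ℝ) => ENNReal.ofReal (Real.exp (θ * h i)))]
  · simp [h2]
  · exact iIndepFun_eval_holdLaw.comp (fun _ x => ENNReal.ofReal (Real.exp (θ * x)))
      (by fun_prop)
  · intro i; fun_prop

/-- Chernoff bound for the event that there are at least `k` jumps by time `t`. -/
lemma holdLaw_jumpTime_le (k : ℕ) (t : ℝ) :
    holdLaw {h | jumpTime h k ≤ t} ≤ ENNReal.ofReal (Real.exp t * (1 / 2) ^ k) := by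
  have h1 := mul_meas_ge_le_lintegral (μ := holdLaw)
    (f := fun h => ENNReal.ofReal (Real.exp ((-1) * jumpTime h k))) (by fun_prop)
    (ENNReal.ofReal (Real.exp (-t)))
  rw [lintegral_exp_jumpTime (by norm_num)] at h1
  have h2 : {h : ℕ → ℝ | jumpTime h k ≤ t} ⊆ {h | ENNReal.ofReal (Real.exp (-t)) ≤
      ENNReal.ofReal (Real.exp ((-1) * jumpTime h k))} := by
    intro h hh
    have : jumpTime h k ≤ t := hh
    exact ENNReal.ofReal_le_ofReal (Real.exp_le_exp.2 (by linarith))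
  calc holdLaw {h | jumpTime h k ≤ t}
      = ENNReal.ofReal (Real.exp t) * (ENNReal.ofReal (Real.exp (-t)) *
          holdLaw {h | jumpTime h k ≤ t}) := by
        rw [← mul_assoc, ← ENNReal.ofReal_mul (by positivity), ← Real.exp_add]; simp
    _ ≤ ENNReal.ofReal (Real.exp t) * ENNReal.ofReal (1 / (1 - (-1))) ^ k := by
        gcongr
        exact (mul_le_mul_right (measure_mono h2) _).trans h1
    _ = _ := by
        rw [← ENNReal.ofReal_pow (by norm_num), ← ENNReal.ofReal_mul (by positivity)]
        norm_num

/-- Chernoff bound for the event that there are fewer than `k` jumps by time `t`. -/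
lemma holdLaw_lt_jumpTime (k : ℕ) (t : ℝ) :
    holdLaw {h | t < jumpTime h k} ≤ ENNReal.ofReal (Real.exp (-t / 2) * 2 ^ k) := by
  have h1 := mul_meas_ge_le_lintegral (μ := holdLaw)
    (f := fun h => ENNReal.ofReal (Real.exp ((1 / 2) * jumpTime h k))) (by fun_prop)
    (ENNReal.ofReal (Real.exp (t / 2)))
  rw [lintegral_exp_jumpTime (by norm_num)] at h1
  have h2 : {h : ℕ → ℝ | t < jumpTime h k} ⊆ {h | ENNReal.ofReal (Real.exp (t / 2)) ≤
      ENNReal.ofReal (Real.exp ((1 / 2) * jumpTime h k))} := by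
    intro h hh
    have : t < jumpTime h k := hh
    exact ENNReal.ofReal_le_ofReal (Real.exp_le_exp.2 (by linarith))
  calc holdLaw {h | t < jumpTime h k}
      = ENNReal.ofReal (Real.exp (-t / 2)) * (ENNReal.ofReal (Real.exp (t / 2)) *
          holdLaw {h | t < jumpTime h k}) := by
        rw [← mul_assoc, ← ENNReal.ofReal_mul (by positivity), ← Real.exp_add]; ring_nf; simp
    _ ≤ ENNReal.ofReal (Real.exp (-t / 2)) * ENNReal.ofReal (1 / (1 - (1 / 2))) ^ k := by
        gcongr
        exact (mul_le_mul_right (measure_mono h2) _).trans h1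
    _ = _ := by
        rw [← ENNReal.ofReal_pow (by norm_num), ← ENNReal.ofReal_mul (by positivity)]
        norm_num

/-- Waiting times for which the walker makes finitely many jumps in finite time, at distinct
positive times. -/
def Regular (h : ℕ → ℝ) : Prop := (∀ k, 0 < h k) ∧ ∀ t : ℝ, ∃ k, t < jumpTime h k

lemma expMeasure_Iic_zero : expMeasure 1 (Set.Iic 0) = 0 := by
  have h := cdf_expMeasure_eq one_pos 0
  rw [cdf_eq_real] at h
  simpa [measureReal_def, ENNReal.toReal_eq_zero_iff] using h

/-- Explosion is excluded by letting `k` tend to infinity in `holdLaw_jumpTime_le`. -/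
lemma ae_regular : ∀ᵐ h ∂holdLaw, Regular h := by
  have h1 : ∀ᵐ h ∂holdLaw, ∀ k, 0 < h k := by
    rw [ae_all_iff]
    intro k
    have h0 : ∀ᵐ x ∂expMeasure 1, 0 < x := by
      rw [ae_iff]; simpa [Set.Iic] using expMeasure_Iic_zero
    exact (measurePreserving_eval_infinitePi (fun _ : ℕ => expMeasure 1) 
      k).quasiMeasurePreserving.ae h0
  have h2 : ∀ᵐ h ∂holdLaw, ∀ m : ℕ, ∃ k, (m : ℝ) < jumpTime h k := by
    rw [ae_all_iff]
    intro m
    rw [ae_iff]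
    have hb : ∀ k : ℕ, holdLaw {h | ¬ ∃ k, (m : ℝ) < jumpTime h k} ≤
        ENNReal.ofReal (Real.exp m * (1 / 2) ^ k) := by
      intro k
      refine (measure_mono ?_).trans (holdLaw_jumpTime_le k m)
      intro h hh
      have hh' : ¬ ∃ k, (m : ℝ) < jumpTime h k := hh
      push Not at hh'
      exact hh' k
    have hl : Filter.Tendsto (fun k : ℕ => ENNReal.ofReal (Real.exp m * (1 / 2) ^ k))
        Filter.atTop (nhds 0) := by
      rw [← ENNReal.ofReal_zero]
      refine ENNReal.tendsto_ofReal ?_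
      simpa using (tendsto_pow_atTop_nhds_zero_of_lt_one (r := (1 / 2 : ℝ)) (by norm_num)
        (by norm_num)).const_mul (Real.exp m)
    exact le_antisymm (ge_of_tendsto' hl hb) (zero_le)
  filter_upwards [h1, h2] with h hh1 hh2
  refine ⟨hh1, fun t => ?_⟩
  obtain ⟨m, hm⟩ := exists_nat_gt t
  obtain ⟨k, hk⟩ := hh2 m
  exact ⟨k, hm.trans hk⟩

lemma expMeasure_singleton (c : ℝ) : expMeasure 1 {c} = 0 := by
  rw [expMeasure, gammaMeasure]
  exact withDensity_absolutelyContinuous _ _ (measure_singleton c)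

/-- The jump times have no atoms. -/
lemma holdLaw_jumpTime_eq (k : ℕ) (c : ℝ) : holdLaw {h | jumpTime h (k + 1) = c} = 0 := by
  -- The last waiting time is independent of the previous jump time and has no atoms.
  have hind : IndepFun (fun h : ℕ → ℝ => jumpTime h k) (fun h => h k) holdLaw := by
    have := iIndepFun_eval_holdLaw.indepFun_sum_range_succ (by fun_prop) k
    convert this using 1
    ext h
    simp [jumpTime]
  have hmap := (indepFun_iff_map_prod_eq_prod_map_map (by fun_prop)
    (measurable_pi_apply k).aemeasurable).1 hind
  have hS : MeasurableSet {p : ℝ × ℝ | p.1 + p.2 = c} :=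
    measurableSet_eq_fun (by fun_prop) (by fun_prop)
  have h1 : {h : ℕ → ℝ | jumpTime h (k + 1) = c} =
      (fun h : ℕ → ℝ => (jumpTime h k, h k)) ⁻¹' {p : ℝ × ℝ | p.1 + p.2 = c} := by
    ext h; simp [jumpTime_succ]
  rw [h1, ← Measure.map_apply (by fun_prop) hS, hmap]
  have h2 : holdLaw.map (fun h : ℕ → ℝ => h k) = expMeasure 1 :=
    (measurePreserving_eval_infinitePi (fun _ : ℕ => expMeasure 1) k).map_eq
  rw [h2, Measure.measure_prod_null hS]
  filter_upwards with x
  have h3 : Prod.mk x ⁻¹' {p : ℝ × ℝ | p.1 + p.2 = c} = {c - x} := by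
    ext y; simp [eq_sub_iff_add_eq']
  rw [h3]; exact expMeasure_singleton _

/-- Two different walkers almost surely never jump at the same time. -/
lemma ae_jumpTime_ne {n : ℕ} [NeZero n] : ∀ᵐ z ∂walkersLaw n, ∀ a b : ZMod n, a ≠ b → ∀ k l : ℕ,
    jumpTime (z a).1 (k + 1) ≠ jumpTime (z b).1 (l + 1) := by
  simp only [ae_all_iff]
  intro a b hab k l
  have hmap := Measure.infinitePi_map_eval_prod (P := fun _ : ZMod n => walkerLaw) hab
  have h2 : MeasurePreserving (fun z : ZMod n → (ℕ → ℝ) × (ℕ → ℤ) => (z a, z b))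
      (walkersLaw n) (walkerLaw.prod walkerLaw) := ⟨by fun_prop, hmap⟩
  have h3 : MeasurePreserving (Prod.fst : (ℕ → ℝ) × (ℕ → ℤ) → ℕ → ℝ) walkerLaw holdLaw :=
    measurePreserving_fst
  have h4 := (h3.prod h3).comp h2
  have h5 : ∀ᵐ p ∂holdLaw.prod holdLaw, jumpTime p.1 (k + 1) ≠ jumpTime p.2 (l + 1) := by
    rw [ae_iff]
    simp only [ne_eq, not_not]
    rw [Measure.measure_prod_null (measurableSet_eq_fun (by fun_prop) (by fun_prop))]
    filter_upwards with x
    have : Prod.mk x ⁻¹' {p : (ℕ → ℝ) × (ℕ → ℝ) | jumpTime p.1 (k + 1) = jumpTime p.2 (l + 1)} =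
        {h | jumpTime h (l + 1) = jumpTime x (k + 1)} := by
      ext y; simp [eq_comm]
    rw [this]; exact holdLaw_jumpTime_eq _ _
  exact h4.quasiMeasurePreserving.ae h5

lemma measurePreserving_eval_walkersLaw {n : ℕ} (a : ZMod n) :
    MeasurePreserving (fun z : ZMod n → (ℕ → ℝ) × (ℕ → ℤ) => z a) (walkersLaw n) walkerLaw :=
  measurePreserving_eval_infinitePi (fun _ => walkerLaw) a

lemma ae_regular_walkersLaw {n : ℕ} [NeZero n] :
    ∀ᵐ z ∂walkersLaw n, ∀ a, Regular (z a).1 := by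
  rw [ae_all_iff]
  intro a
  have h3 : MeasurePreserving (Prod.fst : (ℕ → ℝ) × (ℕ → ℤ) → ℕ → ℝ) walkerLaw holdLaw :=
    measurePreserving_fst
  exact (h3.comp (measurePreserving_eval_walkersLaw a)).quasiMeasurePreserving.ae ae_regular

lemma ae_step_walkersLaw {n : ℕ} [NeZero n] :
    ∀ᵐ z ∂walkersLaw n, ∀ a k, (z a).2 k = 1 ∨ (z a).2 k = -1 := by
  simp only [ae_all_iff]
  intro a k
  have h3 : MeasurePreserving (Prod.snd : (ℕ → ℝ) × (ℕ → ℤ) → ℕ → ℤ) walkerLaw stepsLaw :=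
    measurePreserving_snd
  have h4 : ∀ᵐ x ∂stepLaw, x = 1 ∨ x = -1 := by
    rw [ae_iff, stepLaw]
    simp
  have h5 := (measurePreserving_eval_infinitePi (fun _ : ℕ => stepLaw) k)
  exact (h5.comp (h3.comp (measurePreserving_eval_walkersLaw a))).quasiMeasurePreserving.ae h4

/-! ### Moments of simple random walk -/

/-- The displacement of a walker after `k` jumps. -/
def walk (s : ℕ → ℤ) (k : ℕ) : ℤ := ∑ i ∈ Finset.range k, s i

@[simp] lemma walk_zero (s : ℕ → ℤ) : walk s 0 = 0 := by simp [walk]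

lemma walk_succ (s : ℕ → ℤ) (k : ℕ) : walk s (k + 1) = walk s k + s k := by
  simp [walk, Finset.sum_range_succ]

lemma walk_succ' (s : ℕ → ℤ) (k : ℕ) : walk s (k + 1) = s 0 + walk (fun i => s (i + 1)) k := by
  simp [walk, Finset.sum_range_succ', add_comm]

lemma walk_neg (s : ℕ → ℤ) (k : ℕ) : walk (fun i => - s i) k = - walk s k := by
  simp [walk]

@[fun_prop] lemma measurable_walk (k : ℕ) : Measurable fun s : ℕ → ℤ => walk s k := by
  unfold walk; fun_prop

/-- The Markov property at the first step. -/
lemma measurePreserving_head_tail :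
    MeasurePreserving (fun s : ℕ → ℤ => (s 0, fun k => s (k + 1))) stepsLaw
      (stepLaw.prod stepsLaw) := by
  let cons : ℤ × (ℕ → ℤ) → ℕ → ℤ := fun p k => Nat.casesOn k p.1 p.2
  have hcons : Measurable cons := by
    refine measurable_pi_lambda _ fun k => ?_
    cases k
    · exact measurable_fst
    · exact (measurable_pi_apply _).comp measurable_snd
  have h : (stepLaw.prod stepsLaw).map cons = stepsLaw := by
    refine Measure.eq_infinitePi _ fun s t ht => ?_
    classical
    obtain ⟨N, hN⟩ : ∃ N, s ⊆ Finset.range (N + 1) := by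
      obtain ⟨N, hN⟩ := s.exists_nat_subset_range
      exact ⟨N, hN.trans (Finset.range_mono (by omega))⟩
    let u : ℕ → Set ℤ := fun i => if i ∈ s then t i else Set.univ
    have hu : ∀ i, MeasurableSet (u i) := by
      intro i
      by_cases hi : i ∈ s <;> simp [u, hi]
    have h1 : ∏ i ∈ s, stepLaw (t i) = ∏ i ∈ Finset.range (N + 1), stepLaw (u i) := by
      rw [← Finset.prod_subset hN]
      · exact Finset.prod_congr rfl fun i hi => by simp [u, hi]
      · intro i _ hi; simp [u, hi]
    have h2 : cons ⁻¹' (Set.pi s t) = u 0 ×ˢ Set.pi (Finset.range N) fun i => u (i + 1) := by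
      ext p
      simp only [Set.mem_preimage, Set.mem_pi, Finset.mem_coe, Set.mem_prod, Finset.mem_range]
      constructor
      · intro hp
        refine ⟨?_, fun i _ => ?_⟩
        · by_cases h0 : 0 ∈ s
          · simpa [u, h0, cons] using hp 0 h0
          · simp [u, h0]
        · by_cases h0 : i + 1 ∈ s
          · simpa [u, h0] using hp (i + 1) h0
          · simp [u, h0]
      · rintro ⟨hp0, hp1⟩ i hi
        cases i with
        | zero => simpa [u, hi, cons] using hp0
        | succ i =>
          have := hp1 i (by have := hN hi; simp at this; omega)
          simpa [u, hi] using this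
    rw [Measure.map_apply hcons (.pi s.countable_toSet fun i _ => ht i), h2, Measure.prod_prod, h1,
      Finset.prod_range_succ', stepsLaw, Measure.infinitePi_pi _ fun i _ => hu (i + 1), mul_comm]
  refine ⟨by fun_prop, ?_⟩
  conv_lhs => rw [← h]
  rw [Measure.map_map (by fun_prop) hcons]
  exact Measure.map_id

lemma measurePreserving_neg_steps :
    MeasurePreserving (fun (s : ℕ → ℤ) k => - s k) stepsLaw stepsLaw := by
  refine ⟨by fun_prop, ?_⟩
  rw [stepsLaw, Measure.infinitePi_map_pi (X := fun _ : ℕ => ℤ) (μ := fun _ => stepLaw)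
    (f := fun _ x => - x) (by fun_prop)]
  congr
  ext1
  simp only [stepLaw, Measure.map_smul]
  rw [Measure.map_add _ _ (by fun_prop), Measure.map_dirac' (by fun_prop),
    Measure.map_dirac' (by fun_prop), neg_neg, add_comm]

lemma lintegral_stepLaw (f : ℤ → ℝ≥0∞) : ∫⁻ x, f x ∂stepLaw = 2⁻¹ * (f 1 + f (-1)) := by
  simp [stepLaw, lintegral_add_measure, mul_add]

lemma lintegral_walk_succ (f : ℤ → ℝ≥0∞) (k : ℕ) :
    ∫⁻ s, f (walk s (k + 1)) ∂stepsLaw =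
      2⁻¹ * ((∫⁻ s, f (walk s k + 1) ∂stepsLaw) + ∫⁻ s, f (walk s k - 1) ∂stepsLaw) := by
  have hf : Measurable f := measurable_of_countable f
  have h1 := measurePreserving_head_tail.lintegral_comp
    (f := fun p : ℤ × (ℕ → ℤ) => f (p.1 + walk p.2 k)) (by fun_prop)
  simp only [← walk_succ'] at h1
  rw [h1, lintegral_prod _ (by fun_prop), lintegral_stepLaw]
  simp only [add_comm (1 : ℤ), add_comm (-1 : ℤ), sub_eq_add_neg]

lemma lintegral_walk_sq (k : ℕ) :
    ∫⁻ s, ENNReal.ofReal ((walk s k : ℝ) ^ 2) ∂stepsLaw = k := by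
  induction k with
  | zero => simp
  | succ k ih =>
    rw [lintegral_walk_succ (fun x => ENNReal.ofReal ((x : ℝ) ^ 2)),
      ← lintegral_add_left (by fun_prop)]
    have : ∀ s : ℕ → ℤ, ENNReal.ofReal (((walk s k + 1 : ℤ) : ℝ) ^ 2) +
        ENNReal.ofReal (((walk s k - 1 : ℤ) : ℝ) ^ 2) =
        2 * (ENNReal.ofReal ((walk s k : ℝ) ^ 2) + 1) := by
      intro s
      rw [← ENNReal.ofReal_add (by positivity) (by positivity), ← ENNReal.ofReal_one,
        ← ENNReal.ofReal_add (by positivity) (by positivity), ← ENNReal.ofReal_ofNat 2,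
        ← ENNReal.ofReal_mul (by positivity)]
      congr 1; push_cast; ring
    simp_rw [this]
    rw [lintegral_const_mul _ (by fun_prop), lintegral_add_left (by fun_prop), ih, ← mul_assoc,
      ENNReal.inv_mul_cancel (by simp) (by simp)]
    simp

lemma lintegral_walk_pow_four (k : ℕ) :
    ∫⁻ s, ENNReal.ofReal ((walk s k : ℝ) ^ 4) ∂stepsLaw ≤ 3 * (k : ℝ≥0∞) ^ 2 := by
  induction k with
  | zero => simp
  | succ k ih =>
    rw [lintegral_walk_succ (fun x => ENNReal.ofReal ((x : ℝ) ^ 4)),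
      ← lintegral_add_left (by fun_prop)]
    have : ∀ s : ℕ → ℤ, ENNReal.ofReal (((walk s k + 1 : ℤ) : ℝ) ^ 4) +
        ENNReal.ofReal (((walk s k - 1 : ℤ) : ℝ) ^ 4) =
        2 * (ENNReal.ofReal ((walk s k : ℝ) ^ 4) +
          (6 * ENNReal.ofReal ((walk s k : ℝ) ^ 2) + 1)) := by
      intro s
      rw [← ENNReal.ofReal_add (by positivity) (by positivity), ← ENNReal.ofReal_one,
        ← ENNReal.ofReal_ofNat 6, ← ENNReal.ofReal_mul (by positivity),
        ← ENNReal.ofReal_add (by positivity) (by positivity),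
        ← ENNReal.ofReal_add (by positivity) (by positivity), ← ENNReal.ofReal_ofNat 2,
        ← ENNReal.ofReal_mul (by positivity)]
      congr 1; push_cast; ring
    simp_rw [this]
    rw [lintegral_const_mul _ (by fun_prop), lintegral_add_left (by fun_prop),
      lintegral_add_left (by fun_prop), lintegral_const_mul _ (by fun_prop), lintegral_walk_sq,
      ← mul_assoc, ENNReal.inv_mul_cancel (by simp) (by simp)]
    simp only [lintegral_const, measure_univ, one_mul, mul_one]
    calc _ ≤ 3 * (k : ℝ≥0∞) ^ 2 + (6 * k + 1) := by gcongr
      _ ≤ 3 * (k : ℝ≥0∞) ^ 2 + (6 * k + 3) := by gcongr; norm_num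
      _ = _ := by push_cast; ring

/-- The walk is at distance at least `√k / 2` from the origin at time `k` with probability bounded
below, by a second moment argument applied to the square of the walk. -/
lemma stepsLaw_walk_sq_ge {k : ℕ} (hk : 0 < k) :
    3 / 16 ≤ stepsLaw.real {s | (k : ℝ) / 4 ≤ (walk s k : ℝ) ^ 2} := by
  set E := {s : ℕ → ℤ | (k : ℝ) / 4 ≤ (walk s k : ℝ) ^ 2}
  have hE : MeasurableSet E := measurableSet_le (by fun_prop) (by fun_prop)
  have hk' : (0 : ℝ) < k := by exact_mod_cast hk
  -- A pointwise version of the Paley–Zygmund inequality: `u / 2 ≤ 1 + 1 / 8 + u ^ 2 / 16` for every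
  -- `u`, and the term `1` is not needed for `u < 1 / 4`.
  have h1 : ∀ s, ENNReal.ofReal (1 / (2 * k)) * ENNReal.ofReal ((walk s k : ℝ) ^ 2) ≤
      E.indicator 1 s + (ENNReal.ofReal (1 / 8) +
        ENNReal.ofReal (1 / (16 * k ^ 2)) * ENNReal.ofReal ((walk s k : ℝ) ^ 4)) := by
    intro s
    rw [← ENNReal.ofReal_mul (by positivity), ← ENNReal.ofReal_mul (by positivity)]
    set u := (walk s k : ℝ) ^ 2 / k with hu
    have e1 : 1 / (2 * (k : ℝ)) * (walk s k : ℝ) ^ 2 = u / 2 := by rw [hu]; field_simp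
    have e2 : 1 / (16 * (k : ℝ) ^ 2) * (walk s k : ℝ) ^ 4 = u ^ 2 / 16 := by rw [hu]; field_simp
    rw [e1, e2]
    have hu0 : 0 ≤ u := by positivity
    by_cases hs : s ∈ E
    · simp only [Set.indicator_of_mem hs, Pi.one_apply]
      rw [← ENNReal.ofReal_one, ← ENNReal.ofReal_add (by positivity) (by positivity),
        ← ENNReal.ofReal_add (by positivity) (by positivity)]
      refine ENNReal.ofReal_le_ofReal ?_
      nlinarith [sq_nonneg (u / 4 - 1)]
    · simp only [Set.indicator_of_notMem hs, zero_add]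
      rw [← ENNReal.ofReal_add (by positivity) (by positivity)]
      refine ENNReal.ofReal_le_ofReal ?_
      have hs' : (walk s k : ℝ) ^ 2 < (k : ℝ) / 4 := not_le.1 hs
      have : u < 1 / 4 := by rw [hu, div_lt_iff₀ hk']; linarith
      nlinarith [sq_nonneg u]
  have h2 := lintegral_mono (μ := stepsLaw) h1
  rw [lintegral_const_mul _ (by fun_prop), lintegral_walk_sq,
    lintegral_add_left (measurable_one.indicator hE), lintegral_indicator_one hE,
    lintegral_add_left (by fun_prop), lintegral_const_mul _ (by fun_prop)] at h2
  simp only [lintegral_const, measure_univ, mul_one] at h2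
  have h3 : ENNReal.ofReal (1 / (2 * k)) * (k : ℝ≥0∞) = ENNReal.ofReal (1 / 2) := by
    rw [← ENNReal.ofReal_natCast, ← ENNReal.ofReal_mul (by positivity)]
    congr 1; field_simp
  have h4 : ENNReal.ofReal (1 / (16 * k ^ 2)) *
      ∫⁻ s, ENNReal.ofReal ((walk s k : ℝ) ^ 4) ∂stepsLaw ≤ ENNReal.ofReal (3 / 16) := by
    refine (mul_le_mul_right (lintegral_walk_pow_four k) _).trans_eq ?_
    rw [← ENNReal.ofReal_natCast, ← ENNReal.ofReal_ofNat 3, ← ENNReal.ofReal_pow (by positivity),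
      ← ENNReal.ofReal_mul (by positivity), ← ENNReal.ofReal_mul (by positivity)]
    congr 1; field_simp
  rw [h3, ← ofReal_measureReal] at h2
  have h5 := h2.trans (add_le_add_right (add_le_add_right h4 _) _)
  rw [← ENNReal.ofReal_add (by positivity) (by positivity),
    ← ENNReal.ofReal_add (by positivity) (by positivity),
    ENNReal.ofReal_le_ofReal_iff (by positivity)] at h5
  linarith

/-- By symmetry, half of the probability in `stepsLaw_walk_sq_ge` is on the positive side. -/
lemma stepsLaw_le_walk {k l : ℕ} (hl : 0 < l) (hk : 4 * l ^ 2 ≤ k) :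
    3 / 32 ≤ stepsLaw.real {s | (l : ℤ) ≤ walk s k} := by
  have hk0 : 0 < k := lt_of_lt_of_le (by positivity) hk
  have h1 := stepsLaw_walk_sq_ge hk0
  have h2 : {s : ℕ → ℤ | (k : ℝ) / 4 ≤ (walk s k : ℝ) ^ 2} ⊆
      {s | (l : ℤ) ≤ walk s k} ∪ (fun (s : ℕ → ℤ) i => - s i) ⁻¹' {s | (l : ℤ) ≤ walk s k} := by
    intro s hs
    have hs' : (k : ℝ) / 4 ≤ (walk s k : ℝ) ^ 2 := hs
    have hk' : (4 * (l : ℝ) ^ 2) ≤ k := by exact_mod_cast hk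
    have h3 : (l : ℝ) ^ 2 ≤ (walk s k : ℝ) ^ 2 := by linarith
    have h4 : (l : ℤ) ≤ |walk s k| := by
      have := sq_le_sq.1 h3
      rw [abs_of_nonneg (by positivity : (0 : ℝ) ≤ l)] at this
      exact_mod_cast this
    simp only [Set.mem_union, Set.mem_preimage, Set.mem_ofPred_eq, walk_neg]
    exact le_abs.1 h4
  have h3 := (measureReal_mono (μ := stepsLaw) h2).trans (measureReal_union_le _ _)
  have h4 : stepsLaw.real ((fun (s : ℕ → ℤ) i => - s i) ⁻¹' {s | (l : ℤ) ≤ walk s k}) =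
      stepsLaw.real {s | (l : ℤ) ≤ walk s k} :=
    measurePreserving_neg_steps.measureReal_preimage
      (measurableSet_le (by fun_prop) (by fun_prop)).nullMeasurableSet
  linarith

/-! ### Survival of simple random walk below a level -/

/-- The probability that simple random walk stays at or below level `i` for `k` steps. -/
noncomputable def survival (k : ℕ) (i : ℤ) : ℝ := stepsLaw.real {s | ∀ j ≤ k, walk s j ≤ i}

lemma measurableSet_survival (k : ℕ) (i : ℤ) :
    MeasurableSet {s : ℕ → ℤ | ∀ j ≤ k, walk s j ≤ i} := by
  have : {s : ℕ → ℤ | ∀ j ≤ k, walk s j ≤ i} = ⋂ j ∈ Finset.range (k + 1), {s | walk s j ≤ i} := by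
    ext s; simp
  rw [this]
  exact Finset.measurableSet_biInter _ fun j _ => measurableSet_le (by fun_prop) (by fun_prop)

lemma survival_nonneg (k : ℕ) (i : ℤ) : 0 ≤ survival k i := measureReal_nonneg

lemma survival_le_one (k : ℕ) (i : ℤ) : survival k i ≤ 1 := measureReal_le_one

lemma survival_zero {i : ℤ} (hi : 0 ≤ i) : survival 0 i = 1 := by
  have : {s : ℕ → ℤ | ∀ j ≤ 0, walk s j ≤ i} = Set.univ := by
    ext s; simp [hi]
  rw [survival, this]; simp

/-- The first step of the walk moves the level by one. -/
lemma survival_succ (k : ℕ) {i : ℤ} (hi : 0 ≤ i) :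
    survival (k + 1) i = (survival k (i - 1) + survival k (i + 1)) / 2 := by
  let E : Set (ℤ × (ℕ → ℤ)) := {p | ∀ j ≤ k, p.1 + walk p.2 j ≤ i}
  have hE : MeasurableSet E := by
    have : E = ⋂ j ∈ Finset.range (k + 1), {p : ℤ × (ℕ → ℤ) | p.1 + walk p.2 j ≤ i} := by
      ext s; simp [E]
    rw [this]
    exact Finset.measurableSet_biInter _ fun j _ => measurableSet_le (by fun_prop) (by fun_prop)
  have h1 : {s : ℕ → ℤ | ∀ j ≤ k + 1, walk s j ≤ i} =
      (fun s : ℕ → ℤ => (s 0, fun k => s (k + 1))) ⁻¹' E := by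
    ext s
    simp only [Set.mem_ofPred_eq, Set.mem_preimage, E, ← walk_succ']
    constructor
    · intro h j hj; exact h (j + 1) (by omega)
    · intro h j hj
      cases j with
      | zero => simpa using hi
      | succ j => exact h j (by omega)
  have h2 := measurePreserving_head_tail.measure_preimage hE.nullMeasurableSet
  rw [Measure.prod_apply hE, lintegral_stepLaw] at h2
  have h3 : Prod.mk 1 ⁻¹' E = {s : ℕ → ℤ | ∀ j ≤ k, walk s j ≤ i - 1} := by
    ext s; simp [E, le_sub_iff_add_le']
  have h4 : Prod.mk (-1) ⁻¹' E = {s : ℕ → ℤ | ∀ j ≤ k, walk s j ≤ i + 1} := by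
    ext s
    simp only [E, Set.mem_preimage, Set.mem_ofPred_eq]
    exact forall₂_congr fun j _ => by constructor <;> intro h <;> linarith
  rw [h3, h4] at h2
  rw [survival, survival, survival, h1, measureReal_def, h2, ENNReal.toReal_mul,
    ENNReal.toReal_add (by simp) (by simp)]
  simp [measureReal_def]
  ring

/-- The eigenfunction `x ↦ sin (π x / M)` of the walk killed at `0` and at `M` bounds the survival
probability from below. -/
lemma cos_pow_mul_sin_le_survival {M : ℕ} (hM : 2 ≤ M) (k : ℕ) :
    ∀ i : ℤ, -1 ≤ i → i + 1 ≤ (M : ℤ) →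
      Real.cos (Real.pi / M) ^ k * Real.sin (Real.pi / M * (i + 1)) ≤ survival k i := by
  have hM0 : (0 : ℝ) < M := by exact_mod_cast (by omega : 0 < M)
  have hcos : 0 ≤ Real.cos (Real.pi / M) := by
    refine Real.cos_nonneg_of_neg_pi_div_two_le_of_le ?_ ?_
    · have : 0 ≤ Real.pi / M := by positivity
      linarith [Real.pi_pos]
    · exact div_le_div_of_nonneg_left Real.pi_pos.le (by norm_num) (by exact_mod_cast hM)
  induction k with
  | zero =>
    intro i hi hiM
    rcases hi.eq_or_lt with rfl | hi
    · simpa using survival_nonneg _ _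
    · rw [survival_zero (by omega)]; simpa using Real.sin_le_one _
  | succ k ih =>
    intro i hi hiM
    rcases hi.eq_or_lt with rfl | hi
    · simpa using survival_nonneg _ _
    rcases hiM.eq_or_lt with hiM | hiM
    · have hiM' : (i : ℝ) + 1 = M := by exact_mod_cast hiM
      rw [hiM', div_mul_cancel₀ _ hM0.ne']; simpa using survival_nonneg _ _
    have h1 := ih (i - 1) (by omega) (by omega)
    have h2 := ih (i + 1) (by omega) (by omega)
    rw [survival_succ k (by omega : 0 ≤ i)]
    push_cast at h1 h2
    have e1 : Real.sin (Real.pi / M * (i - 1 + 1)) + Real.sin (Real.pi / M * (i + 1 + 1)) =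
        2 * (Real.cos (Real.pi / M) * Real.sin (Real.pi / M * (i + 1))) := by
      have a1 : Real.pi / M * (i - 1 + 1) = Real.pi / M * (i + 1) - Real.pi / M := by ring
      have a2 : Real.pi / M * (i + 1 + 1) = Real.pi / M * (i + 1) + Real.pi / M := by ring
      rw [a1, a2, Real.sin_sub, Real.sin_add]; ring
    have e2 : Real.cos (Real.pi / M) ^ (k + 1) * Real.sin (Real.pi / M * (i + 1)) =
        (Real.cos (Real.pi / M) ^ k * Real.sin (Real.pi / M * (i - 1 + 1)) +
          Real.cos (Real.pi / M) ^ k * Real.sin (Real.pi / M * (i + 1 + 1))) / 2 := by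
      rw [← mul_add, e1]; ring
    rw [e2]; linarith

/-- The eigenfunction `x ↦ exp (-θ x)` of the walk bounds the probability of leaving the half line
from above. -/
lemma one_sub_survival_le (θ : ℝ) (k : ℕ) :
    ∀ i : ℤ, -1 ≤ i → 1 - survival k i ≤ Real.cosh θ ^ k * Real.exp (-(θ * (i + 1))) := by
  induction k with
  | zero =>
    intro i hi
    rcases hi.eq_or_lt with rfl | hi
    · simpa using survival_nonneg _ _
    · rw [survival_zero (by omega)]; simpa using (Real.exp_pos _).le
  | succ k ih =>
    intro i hi
    rcases hi.eq_or_lt with rfl | hi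
    · have h1 := survival_nonneg (k + 1) (-1)
      have h2 := one_le_pow₀ (Real.one_le_cosh θ) (n := k + 1)
      simp only [Int.reduceNeg, Int.cast_neg, Int.cast_one, neg_add_cancel, mul_zero, neg_zero,
        Real.exp_zero, mul_one]
      linarith
    have h1 := ih (i - 1) (by omega)
    have h2 := ih (i + 1) (by omega)
    rw [survival_succ k (by omega : 0 ≤ i)]
    push_cast at h1 h2
    have e1 : Real.exp (-(θ * (i - 1 + 1))) + Real.exp (-(θ * (i + 1 + 1))) =
        2 * (Real.cosh θ * Real.exp (-(θ * (i + 1)))) := by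
      have a1 : -(θ * ((i : ℝ) - 1 + 1)) = -(θ * (i + 1)) + θ := by ring
      have a2 : -(θ * ((i : ℝ) + 1 + 1)) = -(θ * (i + 1)) + -θ := by ring
      rw [a1, a2, Real.exp_add, Real.exp_add, Real.cosh_eq]; ring
    have e2 : Real.cosh θ ^ (k + 1) * Real.exp (-(θ * (i + 1))) =
        (Real.cosh θ ^ k * Real.exp (-(θ * (i - 1 + 1))) +
          Real.cosh θ ^ k * Real.exp (-(θ * (i + 1 + 1)))) / 2 := by
      rw [← mul_add, e1]; ring
    rw [e2]; linarith

/-- Within `L ^ 2` steps the walk stays below level `i` with probability of order `i / L`. -/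
lemma le_survival_of_le {L : ℕ} (hL : 0 < L) {i : ℕ} (hi : i + 1 ≤ 2 * L) :
    ((i : ℝ) + 1) / (3 * L) ≤ survival (L ^ 2) i := by
  have hL' : (1 : ℝ) ≤ L := by exact_mod_cast hL
  have hi' : (i : ℝ) + 1 ≤ 2 * L := by exact_mod_cast hi
  have h := cos_pow_mul_sin_le_survival (M := 4 * L) (by omega) (L ^ 2) i
    (by omega) (by omega)
  push_cast at h
  refine le_trans ?_ h
  have hpi := Real.pi_pos
  have hpi2 : Real.pi ^ 2 ≤ 10 := by nlinarith [Real.pi_lt_d2, Real.pi_gt_three]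
  have h1 : 2 / 3 ≤ Real.cos (Real.pi / (4 * L)) ^ (L ^ 2) := by
    have h2 := Real.one_sub_sq_div_two_le_cos (x := Real.pi / (4 * L))
    have h3 : (Real.pi / (4 * L)) ^ 2 / 2 = Real.pi ^ 2 / 32 / (L : ℝ) ^ 2 := by
      field_simp; norm_num
    rw [h3] at h2
    have hL2 : (1 : ℝ) ≤ (L : ℝ) ^ 2 := one_le_pow₀ hL'
    have h4 : Real.pi ^ 2 / 32 / (L : ℝ) ^ 2 ≤ 1 / 3 := by
      rw [div_le_iff₀ (by positivity)]; linarith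
    have h5 := one_add_mul_le_pow (a := -(Real.pi ^ 2 / 32 / (L : ℝ) ^ 2)) (by linarith) (L ^ 2)
    have h6 : ((L ^ 2 : ℕ) : ℝ) * (-(Real.pi ^ 2 / 32 / (L : ℝ) ^ 2)) = -(Real.pi ^ 2 / 32) := by
      push_cast; field_simp
    rw [h6] at h5
    calc (2 / 3 : ℝ) ≤ 1 + -(Real.pi ^ 2 / 32) := by linarith
      _ ≤ _ := h5
      _ ≤ _ := by
        refine pow_le_pow_left₀ (by linarith) ?_ _
        linarith
  have h2 : ((i : ℝ) + 1) / (2 * L) ≤ Real.sin (Real.pi / (4 * L) * (i + 1)) := by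
    have h3 := Real.mul_le_sin (x := Real.pi / (4 * L) * (i + 1)) (by positivity) (by
      rw [div_mul_eq_mul_div, div_le_div_iff₀ (by positivity) (by positivity)]
      nlinarith)
    refine le_trans (le_of_eq ?_) h3
    field_simp; norm_num
  calc ((i : ℝ) + 1) / (3 * L) = 2 / 3 * (((i : ℝ) + 1) / (2 * L)) := by field_simp
    _ ≤ _ := by gcongr

/-- Far from the starting point the survival probability approaches `1` exponentially fast. -/
lemma one_sub_survival_add_le {L : ℕ} (hL : 0 < L) (r : ℕ) :
    1 - survival (L ^ 2) ((2 * L + r : ℕ) : ℤ) ≤ 1 / 4 * Real.exp (-(1 / L)) ^ r := by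
  have hL' : (0 : ℝ) < L := by exact_mod_cast hL
  have h := one_sub_survival_le (1 / L) (L ^ 2) ((2 * L + r : ℕ) : ℤ)
    (by omega)
  refine h.trans ?_
  have h1 : Real.cosh (1 / L) ^ (L ^ 2) ≤ Real.exp (1 / 2) := by
    refine (pow_le_pow_left₀ (Real.cosh_pos _).le (Real.cosh_le_exp_half_sq _) _).trans_eq ?_
    rw [← Real.exp_nat_mul]
    congr 1; push_cast; field_simp
  have h2 : Real.exp (-(1 / (L : ℝ) * (((2 * L + r : ℕ) : ℤ) + 1))) ≤
      Real.exp (-2) * Real.exp (-(1 / L)) ^ r := by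
    rw [← Real.exp_nat_mul, ← Real.exp_add]
    apply Real.exp_le_exp.2
    push_cast
    have : 1 / (L : ℝ) * (2 * L + r + 1) = 2 + r * (1 / L) + 1 / L := by field_simp
    rw [this]
    have : 0 ≤ 1 / (L : ℝ) := by positivity
    linarith
  calc _ ≤ Real.exp (1 / 2) * (Real.exp (-2) * Real.exp (-(1 / L)) ^ r) := by gcongr
    _ = Real.exp (-(3 / 2)) * Real.exp (-(1 / L)) ^ r := by
      rw [← mul_assoc, ← Real.exp_add]; norm_num
    _ ≤ _ := by
      gcongr
      rw [Real.exp_neg, inv_le_comm₀ (by positivity) (by norm_num)]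
      have := Real.quadratic_le_exp_of_nonneg (x := 3 / 2) (by norm_num)
      have h3 : Real.exp (3 / 2) = Real.exp 1 * Real.exp (1 / 2) := by
        rw [← Real.exp_add]; norm_num
      have h4 := Real.exp_one_gt_d9
      have h5 := Real.quadratic_le_exp_of_nonneg (x := 1 / 2) (by norm_num)
      rw [h3]
      nlinarith

/-- The probability that independent walks started at every point of a half line all stay there
for `L ^ 2` steps is at least exponentially small in `L`, uniformly in the number of walks. -/
lemma exp_le_prod_survival {L : ℕ} (hL : 0 < L) (R : ℕ) :
    Real.exp (-(4 * L)) ≤ ∏ i ∈ Finset.range R, survival (L ^ 2) (i : ℤ) := by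
  have hL' : (1 : ℝ) ≤ L := by exact_mod_cast hL
  -- The levels below `2 * L` give a factor `(2 * L)! / (3 * L) ^ (2 * L)`, the others a factor
  -- bounded below through a geometric series of ratio `exp (-1 / L)`.
  have h1 : ∏ i ∈ Finset.range (2 * L + R), survival (L ^ 2) (i : ℤ) ≤
      ∏ i ∈ Finset.range R, survival (L ^ 2) (i : ℤ) :=
    Finset.prod_le_prod_of_subset_of_le_one (Finset.range_mono (by omega))
      (fun i _ => survival_nonneg _ _) fun i _ _ => survival_le_one _ _
  refine le_trans ?_ h1
  rw [Finset.prod_range_add]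
  have h2 : Real.exp (-(3 * L)) ≤ ∏ i ∈ Finset.range (2 * L), survival (L ^ 2) (i : ℤ) := by
    have h3 : ∏ i ∈ Finset.range (2 * L), (((i : ℝ) + 1) / (3 * L)) ≤
        ∏ i ∈ Finset.range (2 * L), survival (L ^ 2) (i : ℤ) :=
      Finset.prod_le_prod (fun i _ => by positivity) fun i hi =>
        le_survival_of_le hL (by have := Finset.mem_range.1 hi; omega)
    refine le_trans ?_ h3
    rw [Finset.prod_div_distrib, Finset.prod_const, Finset.card_range]
    have h4 : ∏ i ∈ Finset.range (2 * L), ((i : ℝ) + 1) = ((2 * L).factorial : ℝ) := by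
      rw [← Finset.prod_range_add_one_eq_factorial]; push_cast; rfl
    rw [h4]
    have h5 := Real.pow_div_factorial_le_exp (x := ((2 * L : ℕ) : ℝ)) (by positivity) (2 * L)
    rw [div_le_iff₀ (by positivity)] at h5
    rw [le_div_iff₀ (by positivity)]
    push_cast at h5
    have h6 : (3 * (L : ℝ)) ^ (2 * L) = (2 * L : ℝ) ^ (2 * L) * (9 / 4) ^ L := by
      rw [pow_mul, pow_mul, ← mul_pow]; congr 1; ring
    have h7 : (9 / 4 : ℝ) ^ L ≤ Real.exp L := by
      have : Real.exp L = Real.exp 1 ^ L := by rw [← Real.exp_nat_mul]; simp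
      rw [this]
      exact pow_le_pow_left₀ (by norm_num) (by linarith [Real.exp_one_gt_d9]) _
    calc Real.exp (-(3 * L)) * (3 * (L : ℝ)) ^ (2 * L)
        = Real.exp (-(3 * L)) * ((2 * L : ℝ) ^ (2 * L) * (9 / 4) ^ L) := by rw [h6]
      _ ≤ Real.exp (-(3 * L)) * (Real.exp (2 * L) * ((2 * L).factorial : ℝ) * Real.exp L) := by
        gcongr
      _ = (Real.exp (-(3 * L)) * Real.exp (2 * L) * Real.exp L) * ((2 * L).factorial : ℝ) := by
        ring
      _ = _ := by
        rw [← Real.exp_add, ← Real.exp_add]; ring_nf; simp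
  have h3 : Real.exp (-L) ≤ ∏ r ∈ Finset.range R, survival (L ^ 2) ((2 * L + r : ℕ) : ℤ) := by
    set q := Real.exp (-(1 / (L : ℝ))) with hq
    have hq0 : 0 < q := Real.exp_pos _
    have hq1 : q < 1 := by rw [hq, Real.exp_lt_one_iff]; simp; positivity
    have hx : ∀ r : ℕ, Real.exp (-(2 * (1 / 4 * q ^ r))) ≤
        survival (L ^ 2) ((2 * L + r : ℕ) : ℤ) := by
      intro r
      have h4 := one_sub_survival_add_le hL r
      rw [← hq] at h4
      set x := 1 / 4 * q ^ r
      have hx0 : 0 ≤ x := by positivity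
      have hx1 : x ≤ 1 / 4 := by
        have : q ^ r ≤ 1 := pow_le_one₀ hq0.le hq1.le
        simp only [x]; linarith
      have h5 : Real.exp (-(2 * x)) ≤ 1 - x := by
        rw [Real.exp_neg, inv_le_comm₀ (by positivity) (by linarith)]
        have h6 := Real.add_one_le_exp (2 * x)
        refine le_trans ?_ h6
        rw [inv_le_iff_one_le_mul₀ (by linarith)]
        nlinarith
      linarith
    have hsum : ∑ r ∈ Finset.range R, q ^ r ≤ 1 + L := by
      have h4 : (1 - q) * ∑ r ∈ Finset.range R, q ^ r ≤ 1 := by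
        rw [mul_neg_geom_sum]; have : 0 ≤ q ^ R := by positivity
        linarith
      have h5 : q ≤ L / (1 + L) := by
        rw [hq, Real.exp_neg]
        have h6 := Real.add_one_le_exp (1 / (L : ℝ))
        calc (Real.exp (1 / (L : ℝ)))⁻¹ ≤ (1 / (L : ℝ) + 1)⁻¹ := by gcongr
          _ = _ := by field_simp
      have h6 : 1 / (1 + L) ≤ 1 - q := by
        have : 1 / (1 + (L : ℝ)) = 1 - L / (1 + L) := by field_simp; ring
        linarith
      have h7 : 0 ≤ ∑ r ∈ Finset.range R, q ^ r := Finset.sum_nonneg fun r _ => by positivity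
      have h8 := (mul_le_mul_of_nonneg_right h6 h7).trans h4
      rwa [div_mul_eq_mul_div, one_mul, div_le_one (by positivity)] at h8
    calc Real.exp (-L) ≤ Real.exp (∑ r ∈ Finset.range R, -(2 * (1 / 4 * q ^ r))) := by
          apply Real.exp_le_exp.2
          rw [Finset.sum_neg_distrib, ← Finset.mul_sum, ← Finset.mul_sum]
          linarith
      _ = ∏ r ∈ Finset.range R, Real.exp (-(2 * (1 / 4 * q ^ r))) := Real.exp_sum _ _
      _ ≤ _ := Finset.prod_le_prod (fun r _ => by positivity) fun r _ => hx r
  calc Real.exp (-(4 * L)) = Real.exp (-(3 * L)) * Real.exp (-L) := by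
        rw [← Real.exp_add]; ring_nf
    _ ≤ _ := mul_le_mul h2 h3 (by positivity) (Finset.prod_nonneg fun i _ => survival_nonneg _ _)

/-! ### Order of the walkers on the line -/

lemma Regular.strictMono {h : ℕ → ℝ} (hh : Regular h) : StrictMono (jumpTime h) :=
  strictMono_nat_of_lt_succ fun k => by rw [jumpTime_succ]; linarith [hh.1 k]

/-- Regularity makes the set that `jumpCount` counts finite, so that its `Set.ncard` is not a junk
value. -/
lemma Regular.jumpCount_eq {h : ℕ → ℝ} (hh : Regular h) {t : ℝ≥0} {k : ℕ}
    (h1 : jumpTime h k ≤ t) (h2 : (t : ℝ) < jumpTime h (k + 1)) : jumpCount h t = k := by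
  have : {j : ℕ | ∑ i ∈ Finset.range (j + 1), h i ≤ (t : ℝ)} =
      ((Finset.range k : Finset ℕ) : Set ℕ) := by
    ext j
    simp only [Set.mem_ofPred_eq, Finset.coe_range, Set.mem_Iio]
    change jumpTime h (j + 1) ≤ t ↔ _
    constructor
    · intro hj
      have := hh.strictMono.lt_iff_lt.1 (hj.trans_lt h2)
      omega
    · intro hj
      exact (hh.strictMono.monotone (by omega : j + 1 ≤ k)).trans h1
  rw [jumpCount, this, Set.ncard_coe_finset, Finset.card_range]

lemma Regular.exists_jumpTime_le_lt {h : ℕ → ℝ} (hh : Regular h) (t : ℝ≥0) :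
    ∃ k, jumpTime h k ≤ t ∧ (t : ℝ) < jumpTime h (k + 1) := by
  classical
  have hex := hh.2 t
  have h0 : Nat.find hex ≠ 0 := by
    intro h0
    have := Nat.find_spec hex
    rw [h0, jumpTime_zero] at this
    exact absurd t.2 (not_le.2 this)
  obtain ⟨k, hk⟩ := Nat.exists_eq_succ_of_ne_zero h0
  refine ⟨k, not_lt.1 (Nat.find_min hex (by omega)), ?_⟩
  have := Nat.find_spec hex
  rwa [hk] at this

lemma Regular.jumpTime_jumpCount_le {h : ℕ → ℝ} (hh : Regular h) (t : ℝ≥0) :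
    jumpTime h (jumpCount h t) ≤ t := by
  obtain ⟨k, h1, h2⟩ := hh.exists_jumpTime_le_lt t
  rwa [hh.jumpCount_eq h1 h2]

lemma Regular.lt_jumpTime_jumpCount_add_one {h : ℕ → ℝ} (hh : Regular h) (t : ℝ≥0) :
    (t : ℝ) < jumpTime h (jumpCount h t + 1) := by
  obtain ⟨k, h1, h2⟩ := hh.exists_jumpTime_le_lt t
  rwa [hh.jumpCount_eq h1 h2]

lemma Regular.jumpCount_lt_of_lt_jumpTime {h : ℕ → ℝ} (hh : Regular h) {s t : ℝ≥0} (hst : s ≤ t)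
    {k : ℕ} (hk : (t : ℝ) < jumpTime h k) : jumpCount h s < k :=
  hh.strictMono.lt_iff_lt.1 ((hh.jumpTime_jumpCount_le s).trans_lt
    ((NNReal.coe_le_coe.2 hst).trans_lt hk))

/-- The displacement at time `t` of the walker with input `z`, as an integer. -/
noncomputable def displacement (z : (ℕ → ℝ) × (ℕ → ℤ)) (t : ℝ≥0) : ℤ := walk z.2 (jumpCount z.1 t)

/-- Going backwards in time, the jumps of two walkers that never jump simultaneously can be undone
one at a time. -/
lemma exists_undo_last_jump {h h' : ℕ → ℝ} (hh : Regular h) (hh' : Regular h')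
    (hne : ∀ k l, jumpTime h (k + 1) ≠ jumpTime h' (l + 1)) (t : ℝ≥0)
    (ht : 0 < jumpCount h t + jumpCount h' t) : ∃ s ≤ t,
      (jumpCount h s + 1 = jumpCount h t ∧ jumpCount h' s = jumpCount h' t) ∨
      (jumpCount h s = jumpCount h t ∧ jumpCount h' s + 1 = jumpCount h' t) := by
  -- By symmetry it is enough to treat the case in which the first walker jumps last.
  have key : ∀ {h h' : ℕ → ℝ}, Regular h → Regular h' →
      jumpTime h' (jumpCount h' t) < jumpTime h (jumpCount h t) → ∃ s ≤ t,
      jumpCount h s + 1 = jumpCount h t ∧ jumpCount h' s = jumpCount h' t := by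
    intro h h' hh hh' hlt
    have h0 : 0 ≤ jumpTime h' (jumpCount h' t) := by
      simpa using hh'.strictMono.monotone (Nat.zero_le (jumpCount h' t))
    obtain ⟨j, hj⟩ : ∃ j, jumpCount h t = j + 1 := by
      refine Nat.exists_eq_succ_of_ne_zero fun hz => ?_
      rw [hz, jumpTime_zero] at hlt
      linarith
    rw [hj] at hlt
    have hjt := hh.jumpTime_jumpCount_le t
    rw [hj] at hjt
    have hjj := hh.strictMono (Nat.lt_succ_self j)
    -- The previous jump of either walker.
    let s : ℝ≥0 := ⟨max (jumpTime h j) (jumpTime h' (jumpCount h' t)), h0.trans (le_max_right _ _)⟩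
    have hs : (s : ℝ) < jumpTime h (j + 1) := max_lt hjj hlt
    refine ⟨s, NNReal.coe_le_coe.1 (hs.le.trans hjt), ?_, ?_⟩
    · rw [hj, hh.jumpCount_eq (le_max_left _ _) hs]
    · exact hh'.jumpCount_eq (le_max_right _ _)
        (hs.trans_le (hjt.trans (hh'.lt_jumpTime_jumpCount_add_one t).le))
  rcases lt_trichotomy (jumpTime h (jumpCount h t)) (jumpTime h' (jumpCount h' t)) with
    hlt | heq | hlt
  · obtain ⟨s, hs, h1, h2⟩ := key hh' hh hlt
    exact ⟨s, hs, Or.inr ⟨h2, h1⟩⟩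
  · exfalso
    rcases Nat.eq_zero_or_pos (jumpCount h t) with h0 | h0
    · have h1 := hh'.strictMono (by omega : 0 < jumpCount h' t)
      rw [h0] at heq
      simp only [jumpTime_zero] at heq h1
      linarith
    · rcases Nat.eq_zero_or_pos (jumpCount h' t) with h0' | h0'
      · have h1 := hh.strictMono h0
        rw [h0'] at heq
        simp only [jumpTime_zero] at heq h1
        linarith
      · obtain ⟨k, hk⟩ := Nat.exists_eq_succ_of_ne_zero h0.ne'
        obtain ⟨l, hl⟩ := Nat.exists_eq_succ_of_ne_zero h0'.ne'
        rw [hk, hl] at heq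
        exact hne k l heq
  · obtain ⟨s, hs, h1, h2⟩ := key hh hh' hlt
    exact ⟨s, hs, Or.inl ⟨h1, h2⟩⟩

/-- Two walkers on the line cannot change order without meeting. -/
lemma exists_meeting_time {z z' : (ℕ → ℝ) × (ℕ → ℤ)} (hz : Regular z.1) (hz' : Regular z'.1)
    (hs : ∀ k, z.2 k = 1 ∨ z.2 k = -1) (hs' : ∀ k, z'.2 k = 1 ∨ z'.2 k = -1)
    (hne : ∀ k l, jumpTime z.1 (k + 1) ≠ jumpTime z'.1 (l + 1)) {a b : ℤ} (hab : a < b)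
    (t : ℝ≥0) (ht : b + displacement z' t ≤ a + displacement z t) :
    ∃ s ≤ t, a + displacement z s = b + displacement z' s := by
  -- Undo the jumps until the positions agree: the difference of the positions changes by `1` each
  -- time, and it has the opposite sign at time `0`.
  induction hm : jumpCount z.1 t + jumpCount z'.1 t generalizing t with
  | zero =>
    have h1 : jumpCount z.1 t = 0 := by omega
    have h2 : jumpCount z'.1 t = 0 := by omega
    simp only [displacement, h1, h2, walk_zero] at ht
    omega
  | succ m ih =>
    rcases ht.eq_or_lt with heq | hlt
    · exact ⟨t, le_rfl, heq.symm⟩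
    obtain ⟨s, hst, hcase⟩ := exists_undo_last_jump hz hz' hne t (by omega)
    have hmain : jumpCount z.1 s + jumpCount z'.1 s = m ∧
        b + displacement z' s ≤ a + displacement z s := by
      rcases hcase with ⟨h1, h2⟩ | ⟨h1, h2⟩
      · refine ⟨by omega, ?_⟩
        simp only [displacement, h2, ← h1, walk_succ] at hlt ⊢
        rcases hs (jumpCount z.1 s) with h3 | h3 <;> omega
      · refine ⟨by omega, ?_⟩
        simp only [displacement, h1, ← h2, walk_succ] at hlt ⊢
        rcases hs' (jumpCount z'.1 s) with h3 | h3 <;> omega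
    obtain ⟨r, hr, hr'⟩ := ih s hmain.2 hmain.1
    exact ⟨r, hr.trans hst, hr'⟩

/-- The trajectories of the walkers with inputs `z`. -/
noncomputable def paths {n : ℕ} (z : ZMod n → (ℕ → ℝ) × (ℕ → ℤ)) (w : ZMod n) (t : ℝ≥0) : ZMod n :=
  w + (displacement (z w) t : ZMod n)

/-- All walkers are acquainted by time `t`. -/
def ConnectedBy {W V : Type*} (X : W → ℝ≥0 → V) (t : ℝ≥0) : Prop := ∀ a b : W, HavePathBy X t a b

lemma ConnectedBy.mono {W V : Type*} {X : W → ℝ≥0 → V} {s t : ℝ≥0} (h : ConnectedBy X s)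
    (hst : s ≤ t) : ConnectedBy X t := fun a b =>
  (h a b).lift id fun _ _ ⟨r, hr, hr'⟩ => ⟨r, hr.trans hst, hr'⟩

lemma not_connectedBy_of_lt {W V : Type*} {X : W → ℝ≥0 → V} {t : ℝ≥0}
    (h : (t : ℝ≥0∞) < socialConnectivityTime X) : ¬ ConnectedBy X t := fun hc =>
  absurd h (not_lt.2 (iInf₂_le t hc))

lemma connectedBy_of_lt {W V : Type*} {X : W → ℝ≥0 → V} {t : ℝ≥0}
    (h : socialConnectivityTime X < t) : ConnectedBy X t := by
  rw [socialConnectivityTime, iInf_lt_iff] at h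
  obtain ⟨s, hs⟩ := h
  rw [iInf_lt_iff] at hs
  obtain ⟨hs, hst⟩ := hs
  exact ConnectedBy.mono hs (by exact_mod_cast hst.le)

lemma MetBy.symm {W V : Type*} {X : W → ℝ≥0 → V} {t : ℝ≥0} {a b : W} (h : MetBy X t a b) :
    MetBy X t b a := by
  obtain ⟨s, hs, h⟩ := h
  exact ⟨s, hs, h.symm⟩

lemma HavePathBy.refl {W V : Type*} (X : W → ℝ≥0 → V) (t : ℝ≥0) (a : W) : HavePathBy X t a a :=
  Relation.TransGen.single ⟨0, zero_le, rfl⟩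

lemma HavePathBy.symm {W V : Type*} {X : W → ℝ≥0 → V} {t : ℝ≥0} {a b : W}
    (h : HavePathBy X t a b) : HavePathBy X t b a := by
  have : Std.Symm (MetBy X t) := ⟨fun _ _ => MetBy.symm⟩
  exact Relation.TransGen.stdSymm.symm _ _ h

/-! ### The upper bound for the connectivity time -/

/-- The inputs that occur with probability one: every walker jumps finitely often in finite time,
steps are `±1`, and different walkers never jump at the same time. -/
def Typical {n : ℕ} (z : ZMod n → (ℕ → ℝ) × (ℕ → ℤ)) : Prop :=
  (∀ a, Regular (z a).1) ∧ (∀ a k, (z a).2 k = 1 ∨ (z a).2 k = -1) ∧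
    ∀ a b, a ≠ b → ∀ k l : ℕ, jumpTime (z a).1 (k + 1) ≠ jumpTime (z b).1 (l + 1)

lemma ae_typical {n : ℕ} [NeZero n] : ∀ᵐ z ∂walkersLaw n, Typical z := by
  filter_upwards [ae_regular_walkersLaw, ae_step_walkersLaw, ae_jumpTime_ne] with z h1 h2 h3
  exact ⟨h1, h2, h3⟩

lemma intCast_zmod_injOn {n : ℕ} {i k : ℤ} (h1 : |i - k| < n) (h : (i : ZMod n) = k) : i = k := by
  rw [ZMod.intCast_eq_intCast_iff_dvd_sub] at h
  have := Int.eq_zero_of_abs_lt_dvd h (by rwa [abs_sub_comm])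
  omega

/-- On the universal cover `ℤ` of the cycle, two walkers whose order is reversed at time `t` have
met. -/
lemma Typical.metBy_of_le {n : ℕ} {z : ZMod n → (ℕ → ℝ) × (ℕ → ℤ)} (hz : Typical z) {t : ℝ≥0}
    {i k : ℤ} (hik : i < k) (hn : k - i < n)
    (h : k + displacement (z k) t ≤ i + displacement (z i) t) : MetBy (paths z) t i k := by
  have hne : (i : ZMod n) ≠ k := fun he => by
    have := intCast_zmod_injOn (by rw [abs_sub_lt_iff]; constructor <;> omega) he
    omega
  obtain ⟨s, hs, he⟩ := exists_meeting_time (hz.1 i) (hz.1 k) (hz.2.1 i) (hz.2.1 k)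
    (hz.2.2 _ _ hne) hik t h
  refine ⟨s, hs, ?_⟩
  have := congrArg (Int.cast : ℤ → ZMod n) he
  simpa [paths] using this

lemma connectedBy_of_forall_succ {n : ℕ} [NeZero n] {X : ZMod n → ℝ≥0 → ZMod n} {t : ℝ≥0}
    (h : ∀ x : ℤ, HavePathBy X t x (x + 1 : ℤ)) : ConnectedBy X t := by
  intro a b
  have h1 : ∀ (x : ℤ) (k : ℕ), HavePathBy X t x (x + k : ℤ) := by
    intro x k
    induction k with
    | zero => simpa using HavePathBy.refl X t _
    | succ k ih =>
      refine Relation.TransGen.trans ih ?_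
      have := h (x + k)
      push_cast at this ⊢
      rwa [← add_assoc]
  obtain ⟨x, rfl⟩ := ZMod.intCast_surjective a
  have := h1 x (b - x : ZMod n).val
  push_cast at this
  simpa using this

/-- If near every edge of the cycle some walker has crossed it from the left, and some walker has
crossed it from the right, then all walkers are acquainted. -/
lemma Typical.connectedBy {n : ℕ} [NeZero n] {z : ZMod n → (ℕ → ℝ) × (ℕ → ℤ)} (hz : Typical z)
    {t : ℝ≥0} {L : ℕ} (hL : 2 * L ≤ n)
    (hleft : ∀ x : ℤ, ∃ j < L, (L : ℤ) ≤ displacement (z (x - j : ℤ)) t)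
    (hright : ∀ x : ℤ, ∃ j < L, displacement (z (x + j : ℤ)) t ≤ -L) :
    ConnectedBy (paths z) t := by
  refine connectedBy_of_forall_succ fun x => ?_
  obtain ⟨i, hi, hid⟩ := hleft x
  obtain ⟨k, hk, hkd⟩ := hright (x + 1)
  set a : ℤ := x - i with ha
  set b : ℤ := x + 1 + k with hb
  have hab : MetBy (paths z) t a b := hz.metBy_of_le (by omega) (by omega) (by omega)
  -- Every walker between `a` and `b` has changed order with one of them.
  have hc : ∀ c : ℤ, a ≤ c → c ≤ b → HavePathBy (paths z) t a c := by
    intro c hac hcb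
    rcases hac.eq_or_lt with rfl | hac
    · exact HavePathBy.refl _ _ _
    rcases hcb.eq_or_lt with rfl | hcb
    · exact Relation.TransGen.single hab
    by_cases h : c + displacement (z c) t ≤ a + displacement (z a) t
    · exact Relation.TransGen.single (hz.metBy_of_le hac (by omega) h)
    · have hcb' : MetBy (paths z) t c b := hz.metBy_of_le hcb (by omega) (by omega)
      exact (Relation.TransGen.single hab).trans (Relation.TransGen.single hcb'.symm)
  exact (hc x (by omega) (by omega)).symm.trans (hc (x + 1) (by omega) (by omega))

lemma iIndepFun_eval_walkersLaw (n : ℕ) :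
    iIndepFun (fun (w : ZMod n) (z : ZMod n → (ℕ → ℝ) × (ℕ → ℤ)) => z w) (walkersLaw n) :=
  iIndepFun_infinitePi (X := fun _ x => x) (by fun_prop)

/-- Events about different walkers are independent. -/
lemma walkersLaw_biInter {n : ℕ} {ι : Type*} (s : Finset ι) {f : ι → ZMod n}
    (hf : Set.InjOn f s) {A : ι → Set ((ℕ → ℝ) × (ℕ → ℤ))} (hA : ∀ i, MeasurableSet (A i)) :
    walkersLaw n (⋂ i ∈ s, {z | z (f i) ∈ A i}) = ∏ i ∈ s, walkerLaw (A i) := by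
  have h1 : iIndepFun (fun (i : s) (z : ZMod n → (ℕ → ℝ) × (ℕ → ℤ)) => z (f i)) (walkersLaw n) :=
    (iIndepFun_eval_walkersLaw n).precomp (g := fun i : s => f i) hf.injective
  have h2 := h1.measure_inter_preimage_eq_mul Finset.univ (sets := fun i : s => A i)
    (fun i _ => hA i)
  have h3 : (⋂ i ∈ s, {z : ZMod n → (ℕ → ℝ) × (ℕ → ℤ) | z (f i) ∈ A i}) =
      ⋂ i ∈ (Finset.univ : Finset s), (fun z => z (f i)) ⁻¹' A i := by
    ext z; simp
  rw [h3, h2, ← Finset.prod_coe_sort s]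
  exact Finset.prod_congr rfl fun i _ =>
    (measurePreserving_eval_walkersLaw (f i)).measure_preimage (hA i).nullMeasurableSet

/-- The inputs for which the walker makes at least `m` jumps by time `t` and is then at distance at
least `l` to the right of its starting point. -/
def farRight (m l : ℕ) (t : ℝ≥0) : Set ((ℕ → ℝ) × (ℕ → ℤ)) :=
  {z | ∃ k ≥ m, jumpTime z.1 k ≤ t ∧ (t : ℝ) < jumpTime z.1 (k + 1) ∧ (l : ℤ) ≤ walk z.2 k}

lemma measurableSet_farRight (m l : ℕ) (t : ℝ≥0) : MeasurableSet (farRight m l t) := by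
  have : farRight m l t = ⋃ k, ⋃ (_ : k ≥ m), ({z | jumpTime z.1 k ≤ t} ∩
      ({z | (t : ℝ) < jumpTime z.1 (k + 1)} ∩ {z | (l : ℤ) ≤ walk z.2 k})) := by
    ext z; simp [farRight, and_left_comm]
  rw [this]
  refine MeasurableSet.iUnion fun k => MeasurableSet.iUnion fun _ => ?_
  refine (measurableSet_le (by fun_prop) (by fun_prop)).inter
    ((measurableSet_lt (by fun_prop) (by fun_prop)).inter
      (measurableSet_le (by fun_prop) ?_))
  exact (measurable_walk k).comp measurable_snd

lemma Regular.le_displacement_of_mem_farRight {z : (ℕ → ℝ) × (ℕ → ℤ)} (hz : Regular z.1) {m l : ℕ}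
    {t : ℝ≥0} (h : z ∈ farRight m l t) : (l : ℤ) ≤ displacement z t := by
  obtain ⟨k, -, h1, h2, h3⟩ := h
  rwa [displacement, hz.jumpCount_eq h1 h2]

/-- The probability that a walker is far to the right at time `t` is bounded below, on the diffusive
scale. -/
lemma walkerLaw_farRight {l : ℕ} (hl : 0 < l) {t : ℝ≥0} (ht : 2 * (4 * (l : ℝ) ^ 2 + 1) ≤ t) :
    3 / 64 ≤ walkerLaw.real (farRight (4 * l ^ 2) l t) := by
  set m := 4 * l ^ 2 with hm
  set D : Set (ℕ → ℝ) := {h | jumpTime h m ≤ t}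
  have hDm : MeasurableSet D := measurableSet_le (by fun_prop) (by fun_prop)
  have hD : 1 / 2 ≤ holdLaw.real D := by
    have h1 := holdLaw_lt_jumpTime m t
    have h2 : {h : ℕ → ℝ | (t : ℝ) < jumpTime h m} = Dᶜ := by ext h; simp [D]
    rw [h2, ← ofReal_measureReal, ENNReal.ofReal_le_ofReal_iff (by positivity),
      probReal_compl_eq_one_sub hDm] at h1
    have h3 : Real.exp (-(t : ℝ) / 2) * 2 ^ m ≤ 1 / 2 := by
      have h4 : Real.exp (-(t : ℝ) / 2) ≤ Real.exp (-1) ^ (m + 1) := by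
        rw [← Real.exp_nat_mul]
        apply Real.exp_le_exp.2
        rw [hm]; push_cast; linarith
      have h5 : Real.exp (-1) ≤ 1 / 2 := by
        rw [Real.exp_neg, inv_le_comm₀ (Real.exp_pos _) (by norm_num)]
        linarith [Real.exp_one_gt_d9]
      calc Real.exp (-(t : ℝ) / 2) * 2 ^ m ≤ (1 / 2) ^ (m + 1) * 2 ^ m := by
            gcongr
            exact h4.trans (pow_le_pow_left₀ (Real.exp_pos _).le h5 _)
        _ = 1 / 2 := by rw [pow_succ, mul_right_comm, ← mul_pow]; norm_num
    linarith
  have h1 : ENNReal.ofReal (3 / 32) * holdLaw D ≤ walkerLaw (farRight m l t) := by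
    rw [walkerLaw, Measure.prod_apply (measurableSet_farRight m l t),
      ← lintegral_indicator_const hDm]
    refine lintegral_mono_ae ?_
    filter_upwards [ae_regular] with h hh
    by_cases hhD : h ∈ D
    · rw [Set.indicator_of_mem hhD]
      obtain ⟨k, hk1, hk2⟩ := hh.exists_jumpTime_le_lt t
      have hkm : m ≤ k := by
        have := hh.strictMono.lt_iff_lt.1 (lt_of_le_of_lt hhD hk2)
        omega
      have h2 : {s : ℕ → ℤ | (l : ℤ) ≤ walk s k} ⊆ Prod.mk h ⁻¹' farRight m l t :=
        fun s hs => ⟨k, hkm, hk1, hk2, hs⟩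
      refine le_trans ?_ (measure_mono h2)
      rw [← ofReal_measureReal]
      exact ENNReal.ofReal_le_ofReal (stepsLaw_le_walk hl hkm)
    · rw [Set.indicator_of_notMem hhD]; exact zero_le
  rw [← ofReal_measureReal, ← ofReal_measureReal (μ := walkerLaw),
    ← ENNReal.ofReal_mul (by norm_num), ENNReal.ofReal_le_ofReal_iff measureReal_nonneg] at h1
  linarith

/-- Reflection of the steps of a walker. -/
def reflect (z : (ℕ → ℝ) × (ℕ → ℤ)) : (ℕ → ℝ) × (ℕ → ℤ) := (z.1, fun k => - z.2 k)

lemma displacement_reflect (z : (ℕ → ℝ) × (ℕ → ℤ)) (t : ℝ≥0) :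
    displacement (reflect z) t = - displacement z t := walk_neg _ _

lemma measurePreserving_reflect : MeasurePreserving reflect walkerLaw walkerLaw :=
  (MeasurePreserving.id holdLaw).prod measurePreserving_neg_steps

lemma walkersLaw_forall_notMem_le {n : ℕ} {L : ℕ} {f : ℕ → ZMod n}
    (hf : Set.InjOn f (Finset.range L)) {A : Set ((ℕ → ℝ) × (ℕ → ℤ))} (hA : MeasurableSet A)
    {p : ℝ} (hp : p ≤ walkerLaw.real A) :
    walkersLaw n {z | ∀ j < L, z (f j) ∉ A} ≤ ENNReal.ofReal ((1 - p) ^ L) := by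
  have h1 : {z : ZMod n → (ℕ → ℝ) × (ℕ → ℤ) | ∀ j < L, z (f j) ∉ A} =
      ⋂ j ∈ Finset.range L, {z | z (f j) ∈ Aᶜ} := by
    ext z; simp
  have hp1 : walkerLaw.real A ≤ 1 := measureReal_le_one
  rw [h1, walkersLaw_biInter _ hf fun _ => hA.compl, Finset.prod_const, Finset.card_range,
    ENNReal.ofReal_pow (by linarith)]
  gcongr
  rw [← ofReal_measureReal, probReal_compl_eq_one_sub hA]
  exact ENNReal.ofReal_le_ofReal (by linarith)

lemma intCast_injOn_range {n L : ℕ} (hL : L ≤ n) (x : ℤ) :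
    Set.InjOn (fun j : ℕ => ((x + j : ℤ) : ZMod n)) (Finset.range L) := by
  intro i hi k hk h
  simp only [Finset.coe_range, Set.mem_Iio] at hi hk
  have := intCast_zmod_injOn (by rw [abs_sub_lt_iff]; constructor <;> omega) h
  omega

lemma intCast_sub_injOn_range {n L : ℕ} (hL : L ≤ n) (x : ℤ) :
    Set.InjOn (fun j : ℕ => ((x - j : ℤ) : ZMod n)) (Finset.range L) := by
  intro i hi k hk h
  simp only [Finset.coe_range, Set.mem_Iio] at hi hk
  have := intCast_zmod_injOn (by rw [abs_sub_lt_iff]; constructor <;> omega) h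
  omega

/-- After a time of order `L ^ 2`, the probability that the walkers are not all acquainted is at
most the number of edges times an exponentially small quantity in `L`. -/
lemma walkersLaw_not_connectedBy_le {n : ℕ} [NeZero n] {L : ℕ} (hL0 : 0 < L) (hL : 2 * L ≤ n)
    {t : ℝ≥0} (ht : 2 * (4 * (L : ℝ) ^ 2 + 1) ≤ t) :
    walkersLaw n {z | ¬ ConnectedBy (paths z) t} ≤
      ENNReal.ofReal (n * (2 * (1 - 3 / 64) ^ L)) := by
  set A := farRight (4 * L ^ 2) L t
  have hA : MeasurableSet A := measurableSet_farRight _ _ _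
  have hp : 3 / 64 ≤ walkerLaw.real A := walkerLaw_farRight hL0 ht
  have hp' : 3 / 64 ≤ walkerLaw.real (reflect ⁻¹' A) := by
    rwa [measurePreserving_reflect.measureReal_preimage hA.nullMeasurableSet]
  have hA' : MeasurableSet (reflect ⁻¹' A) := measurePreserving_reflect.measurable hA
  set E : ℕ → Set (ZMod n → (ℕ → ℝ) × (ℕ → ℤ)) := fun x =>
    {z | ∀ j < L, z (((x : ℤ) - j : ℤ) : ZMod n) ∉ A} ∪
      {z | ∀ j < L, z (((x : ℤ) + j : ℤ) : ZMod n) ∉ reflect ⁻¹' A}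
  have hsub : ∀ᵐ z ∂walkersLaw n, z ∈ {z | ¬ ConnectedBy (paths z) t} →
      z ∈ ⋃ x ∈ Finset.range n, E x := by
    filter_upwards [ae_typical] with z hz hnc
    by_contra hE
    refine hnc (hz.connectedBy hL (fun x => ?_) (fun x => ?_))
    all_goals
      have hx : ((x : ZMod n).val) < n := ZMod.val_lt _
      have hE' : z ∉ E (x : ZMod n).val := fun h => hE (Set.mem_biUnion (Finset.mem_range.2 hx) h)
      simp only [E, Set.mem_union, not_or, Set.mem_ofPred_eq] at hE'
      push Not at hE'
    · obtain ⟨j, hj, hjA⟩ := hE'.1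
      refine ⟨j, hj, ?_⟩
      have := (hz.1 _).le_displacement_of_mem_farRight hjA
      push_cast at this ⊢
      simpa using this
    · obtain ⟨j, hj, hjA⟩ := hE'.2
      refine ⟨j, hj, ?_⟩
      have := Regular.le_displacement_of_mem_farRight (z := reflect _) (hz.1 _) hjA
      rw [displacement_reflect] at this
      push_cast at this ⊢
      simp at this ⊢
      linarith
  calc walkersLaw n {z | ¬ ConnectedBy (paths z) t}
      ≤ walkersLaw n (⋃ x ∈ Finset.range n, E x) := measure_mono_ae hsub
    _ ≤ ∑ x ∈ Finset.range n, walkersLaw n (E x) := measure_biUnion_finset_le _ _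
    _ ≤ ∑ x ∈ Finset.range n, ENNReal.ofReal (2 * (1 - 3 / 64) ^ L) := by
      refine Finset.sum_le_sum fun x _ => (measure_union_le _ _).trans ?_
      rw [two_mul, ENNReal.ofReal_add (by positivity) (by positivity)]
      exact add_le_add
        (walkersLaw_forall_notMem_le (intCast_sub_injOn_range (by omega) _) hA hp)
        (walkersLaw_forall_notMem_le (intCast_injOn_range (by omega) _) hA' hp')
    _ = _ := by
      rw [Finset.sum_const, Finset.card_range, nsmul_eq_mul,
        ENNReal.ofReal_mul (p := (n : ℝ)) (by positivity), ENNReal.ofReal_natCast]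

lemma one_le_log_of_three_le {n : ℕ} (hn : 3 ≤ n) : 1 ≤ Real.log n := by
  rw [Real.le_log_iff_exp_le (by positivity)]
  have : (3 : ℝ) ≤ n := by exact_mod_cast hn
  linarith [Real.exp_one_lt_d9]

/-- The choice of `L` makes `(1 - 3 / 64) ^ L` at most `1 / n ^ 2`, and `20810 = 8 * 51 ^ 2 + 2`
comes from `L ≤ 51 * log n`. The bound is at least `1` whenever `2 * L > n`. -/
lemma walkersLaw_not_connectedBy_log_sq_le {n : ℕ} (hn : 3 ≤ n) :
    walkersLaw n {z | ¬ ConnectedBy (paths z) (20810 * Real.log n ^ 2).toNNReal} ≤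
      ENNReal.ofReal (41616 / n) := by
  have : NeZero n := ⟨by omega⟩
  have hlog := one_le_log_of_three_le hn
  have hn0 : (0 : ℝ) < n := by positivity
  set L := ⌈50 * Real.log n⌉₊ with hL
  have hL1 : 50 * Real.log n ≤ L := Nat.le_ceil _
  have hL2 : (L : ℝ) ≤ 51 * Real.log n := by
    have := (Nat.ceil_lt_add_one (by positivity : 0 ≤ 50 * Real.log n)).le
    linarith
  rcases le_or_gt (2 * L) n with h | h
  · refine (walkersLaw_not_connectedBy_le (Nat.ceil_pos.2 (by positivity)) h ?_).trans
      (ENNReal.ofReal_le_ofReal ?_)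
    · rw [Real.coe_toNNReal _ (by positivity)]
      have h1 : (L : ℝ) ^ 2 ≤ (51 * Real.log n) ^ 2 := by gcongr
      nlinarith
    · have h1 : (1 - 3 / 64 : ℝ) ^ L ≤ 1 / (n : ℝ) ^ 2 := by
        calc (1 - 3 / 64 : ℝ) ^ L ≤ Real.exp (-(3 / 64)) ^ L := by
              refine pow_le_pow_left₀ (by norm_num) ?_ _
              linarith [Real.add_one_le_exp (-(3 / 64 : ℝ))]
          _ = Real.exp (L * (-(3 / 64))) := by rw [← Real.exp_nat_mul]
          _ ≤ Real.exp (-(2 * Real.log n)) := by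
              apply Real.exp_le_exp.2
              linarith
          _ = _ := by
              rw [Real.exp_neg, two_mul, Real.exp_add, Real.exp_log hn0]
              field_simp
      calc (n : ℝ) * (2 * (1 - 3 / 64) ^ L) ≤ n * (2 * (1 / (n : ℝ) ^ 2)) := by gcongr
        _ = 2 / n := by field_simp
        _ ≤ _ := by gcongr; norm_num
  · -- For the finitely many remaining `n` the bound exceeds `1`.
    refine prob_le_one.trans ?_
    rw [ENNReal.one_le_ofReal, one_le_div hn0]
    have h1 : (n : ℝ) ≤ 102 * Real.log n := by
      have : (n : ℝ) < 2 * L := by exact_mod_cast h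
      linarith
    have h2 : Real.log n ≤ 2 * Real.sqrt n := by
      have h3 := Real.log_le_sub_one_of_pos (Real.sqrt_pos.2 hn0)
      rw [Real.log_sqrt hn0.le] at h3
      linarith
    have h4 := Real.sq_sqrt hn0.le
    have h5 := Real.sqrt_pos.2 hn0
    have h6 : Real.sqrt n ≤ 204 := by
      by_contra h7
      push Not at h7
      nlinarith
    nlinarith

/-! ### Barriers -/

/-- The inputs for which the walker makes at most `K` jumps by time `t`, and its first `K` jumps
never take it more than `i` to the right of its starting point. -/
def staysBelow (K i : ℕ) (t : ℝ≥0) : Set ((ℕ → ℝ) × (ℕ → ℤ)) :=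
  {h | (t : ℝ) < jumpTime h (K + 1)} ×ˢ {s | ∀ k ≤ K, walk s k ≤ i}

lemma measurableSet_staysBelow (K i : ℕ) (t : ℝ≥0) : MeasurableSet (staysBelow K i t) :=
  (measurableSet_lt (by fun_prop) (by fun_prop)).prod (measurableSet_survival K i)

lemma Regular.displacement_le_of_mem_staysBelow {z : (ℕ → ℝ) × (ℕ → ℤ)} (hz : Regular z.1)
    {K i : ℕ} {t : ℝ≥0} (h : z ∈ staysBelow K i t) {s : ℝ≥0} (hs : s ≤ t) :
    displacement z s ≤ i :=
  h.2 _ (Nat.lt_succ_iff.1 (hz.jumpCount_lt_of_lt_jumpTime hs h.1))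

lemma exp_half_le_two : Real.exp (1 / 2) ≤ 2 := by
  have h : Real.exp 1 = Real.exp (1 / 2) ^ 2 := by rw [← Real.exp_nat_mul]; norm_num
  nlinarith [Real.exp_one_lt_d9, Real.exp_pos (1 / 2)]

lemma half_pow_le_exp (k : ℕ) : (1 / 2 : ℝ) ^ k ≤ Real.exp (-(k / 2)) := by
  have h : Real.exp (-((k : ℝ) / 2)) = Real.exp (-(1 / 2)) ^ k := by
    rw [← Real.exp_nat_mul]; congr 1; ring
  rw [h]
  refine pow_le_pow_left₀ (by norm_num) ?_ _
  rw [Real.exp_neg, le_inv_comm₀ (by norm_num) (Real.exp_pos _)]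
  simpa using exp_half_le_two

lemma le_walkerLaw_staysBelow {L : ℕ} {t : ℝ≥0} (ht : (t : ℝ) ≤ (L : ℝ) ^ 2 / 4)
    (i : ℕ) : (1 - Real.exp (-((L : ℝ) ^ 2 / 4))) * survival (L ^ 2) i ≤
      walkerLaw.real (staysBelow (L ^ 2) i t) := by
  rw [walkerLaw, staysBelow, measureReal_prod_prod]
  refine mul_le_mul_of_nonneg_right ?_ (survival_nonneg _ _)
  have hm : MeasurableSet {h : ℕ → ℝ | jumpTime h (L ^ 2 + 1) ≤ t} :=
    measurableSet_le (by fun_prop) (by fun_prop)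
  have h1 : {h : ℕ → ℝ | (t : ℝ) < jumpTime h (L ^ 2 + 1)} =
      {h | jumpTime h (L ^ 2 + 1) ≤ t}ᶜ := by ext h; simp
  rw [h1, probReal_compl_eq_one_sub hm]
  have h2 := holdLaw_jumpTime_le (L ^ 2 + 1) t
  rw [← ofReal_measureReal, ENNReal.ofReal_le_ofReal_iff (by positivity)] at h2
  have h3 := half_pow_le_exp (L ^ 2 + 1)
  have h4 : Real.exp t * (1 / 2) ^ (L ^ 2 + 1) ≤ Real.exp (-((L : ℝ) ^ 2 / 4)) := by
    refine (mul_le_mul_of_nonneg_left h3 (Real.exp_pos _).le).trans ?_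
    rw [← Real.exp_add]
    apply Real.exp_le_exp.2
    push_cast; linarith
  linarith

/-- The edge from `x` to `x + 1` is a barrier: among the `2 * m` walkers nearest to it, each one
makes at most `K` jumps by time `t` and stays on its own side. -/
def barrier {n : ℕ} (m K : ℕ) (t : ℝ≥0) (x : ℤ) : Set (ZMod n → (ℕ → ℝ) × (ℕ → ℤ)) :=
  {z | ∀ j < m, z (x - j : ℤ) ∈ staysBelow K j t ∧ reflect (z (x + 1 + j : ℤ)) ∈ staysBelow K j t}

lemma barrier_add_card {n : ℕ} (m K : ℕ) (t : ℝ≥0) (x : ℤ) :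
    barrier (n := n) m K t (x + n) = barrier m K t x := by
  simp [barrier]

/-- The walkers concerned by the barriers at `x + 2 * m * b`: the walkers to the left of the edge
carry the label `false`. -/
def barrierWalker (m : ℕ) (x : ℤ) (p : ℕ × ℕ × Bool) : ℤ :=
  if p.2.2 then x + 2 * m * p.1 + 1 + p.2.1 else x + 2 * m * p.1 - p.2.1

/-- The event that the barriers require of each walker. -/
def barrierEvent (K : ℕ) (t : ℝ≥0) (p : ℕ × ℕ × Bool) : Set ((ℕ → ℝ) × (ℕ → ℤ)) :=
  if p.2.2 then reflect ⁻¹' staysBelow K p.2.1 t else staysBelow K p.2.1 t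

lemma measurableSet_barrierEvent (K : ℕ) (t : ℝ≥0) (p : ℕ × ℕ × Bool) :
    MeasurableSet (barrierEvent K t p) := by
  unfold barrierEvent
  split_ifs
  · exact measurePreserving_reflect.measurable (measurableSet_staysBelow _ _ _)
  · exact measurableSet_staysBelow _ _ _

lemma walkerLaw_barrierEvent (K : ℕ) (t : ℝ≥0) (p : ℕ × ℕ × Bool) :
    walkerLaw (barrierEvent K t p) = walkerLaw (staysBelow K p.2.1 t) := by
  unfold barrierEvent
  split_ifs
  · exact measurePreserving_reflect.measure_preimage
      (measurableSet_staysBelow _ _ _).nullMeasurableSet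
  · rfl

lemma barrierWalker_injOn {n m B : ℕ} (hn : 2 * m * B ≤ n) (x : ℤ) :
    Set.InjOn (fun p => ((barrierWalker m x p : ℤ) : ZMod n))
      (Finset.range B ×ˢ (Finset.range m ×ˢ (Finset.univ : Finset Bool)) :
        Finset (ℕ × ℕ × Bool)) := by
  rintro ⟨b, i, β⟩ hp ⟨b', i', β'⟩ hp' h
  simp only [Finset.coe_product, Finset.coe_range, Finset.coe_univ, Set.mem_prod, Set.mem_Iio,
    Set.mem_univ, and_true] at hp hp'
  -- The walkers of the neighbourhood number `b` fill an interval of length `2 * m`.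
  have hbd : ∀ (b i : ℕ) (β : Bool), b < B → i < m →
      ∃ r : ℤ, 0 ≤ r ∧ r < 2 * m ∧ barrierWalker m x (b, i, β) = x - m + 1 + 2 * m * b + r ∧
        0 ≤ 2 * (m : ℤ) * b + r ∧ 2 * (m : ℤ) * b + r < n := by
    intro b i β hb hi
    have h1 : 2 * (m : ℤ) * (b + 1) ≤ 2 * m * B := by
      have : (b : ℤ) + 1 ≤ B := by exact_mod_cast hb
      gcongr
    have h2 : 2 * (m : ℤ) * B ≤ n := by exact_mod_cast hn
    have h3 : 0 ≤ 2 * (m : ℤ) * b := by positivity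
    cases β
    · refine ⟨m - 1 - i, by omega, by omega, ?_, by omega, by linarith⟩
      simp [barrierWalker]; ring
    · refine ⟨m + i, by omega, by omega, ?_, by omega, by linarith⟩
      simp [barrierWalker]; ring
  obtain ⟨r, hr0, hr1, hr2, hr3, hr4⟩ := hbd b i β hp.1 hp.2
  obtain ⟨r', hr0', hr1', hr2', hr3', hr4'⟩ := hbd b' i' β' hp'.1 hp'.2
  have he : barrierWalker m x (b, i, β) = barrierWalker m x (b', i', β') :=
    intCast_zmod_injOn (by rw [hr2, hr2', abs_sub_lt_iff]; constructor <;> linarith) h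
  have hb : b = b' := by
    have h1 : 2 * (m : ℤ) * b + r = 2 * m * b' + r' := by linarith
    rcases lt_trichotomy b b' with hlt | heq | hlt
    · have : 2 * (m : ℤ) * (b + 1) ≤ 2 * m * b' := by
        have : (b : ℤ) + 1 ≤ b' := by exact_mod_cast hlt
        gcongr
      linarith
    · exact heq
    · have : 2 * (m : ℤ) * (b' + 1) ≤ 2 * m * b := by
        have : (b' : ℤ) + 1 ≤ b := by exact_mod_cast hlt
        gcongr
      linarith
  subst hb
  have hi := hp.2
  have hi' := hp'.2
  cases β <;> cases β' <;> simp [barrierWalker] at he <;> first | (subst he; rfl) | omega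

lemma barrier_eq_biInter {n : ℕ} (m K : ℕ) (t : ℝ≥0) (x : ℤ) (b : ℕ) :
    barrier (n := n) m K t (x + 2 * m * b) =
      ⋂ p ∈ ({b} : Finset ℕ) ×ˢ (Finset.range m ×ˢ (Finset.univ : Finset Bool)),
        {z | z ((barrierWalker m x p : ℤ) : ZMod n) ∈ barrierEvent K t p} := by
  ext z
  simp only [barrier, barrierWalker, barrierEvent, Set.mem_ofPred_eq, Set.mem_iInter,
    Finset.mem_product, Finset.mem_singleton, Finset.mem_range, Finset.mem_univ, and_true,
    Prod.forall]
  constructor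
  · rintro h b' i β ⟨rfl, hi⟩
    cases β
    · simpa using (h i hi).1
    · simpa using (h i hi).2
  · intro h j hj
    have h1 := h b j false ⟨rfl, hj⟩
    have h2 := h b j true ⟨rfl, hj⟩
    simp only [Bool.false_eq_true, if_false, if_true] at h1 h2
    exact ⟨h1, h2⟩

lemma measurableSet_barrier {n : ℕ} (m K : ℕ) (t : ℝ≥0) (x : ℤ) :
    MeasurableSet (barrier (n := n) m K t x) := by
  have h := barrier_eq_biInter (n := n) m K t x 0
  simp only [Nat.cast_zero, mul_zero, add_zero] at h
  rw [h]
  exact Finset.measurableSet_biInter _ fun p _ =>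
    (measurable_pi_apply _) (measurableSet_barrierEvent K t p)

lemma walkersLaw_barrier {n m : ℕ} (hn : 2 * m ≤ n) (K : ℕ) (t : ℝ≥0) (x : ℤ) :
    walkersLaw n (barrier m K t x) =
      (∏ j ∈ Finset.range m, walkerLaw (staysBelow K j t)) ^ 2 := by
  have h := barrier_eq_biInter (n := n) m K t x 0
  simp only [Nat.cast_zero, mul_zero, add_zero] at h
  have hinj := barrierWalker_injOn (n := n) (m := m) (B := 1) (by omega) x
  rw [Finset.range_one] at hinj
  rw [h, walkersLaw_biInter _ hinj (measurableSet_barrierEvent K t)]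
  simp only [walkerLaw_barrierEvent, Finset.prod_product, Finset.prod_const,
    Finset.card_univ, Fintype.card_bool, Finset.prod_pow, Finset.card_singleton, pow_one]

/-- Barriers at edges whose neighbourhoods are disjoint are independent. -/
lemma iIndepSet_barrier {n m B : ℕ} (hn : 2 * m * B ≤ n) (K : ℕ) (t : ℝ≥0) (x : ℤ) :
    iIndepSet (fun b : Fin B => barrier (n := n) m K t (x + 2 * m * (b : ℕ))) (walkersLaw n) := by
  rw [iIndepSet_iff_meas_biInter fun b => measurableSet_barrier _ _ _ _]
  intro s
  let J : Finset (ℕ × Bool) := Finset.range m ×ˢ Finset.univ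
  have hinj := barrierWalker_injOn hn x
  have hval : ∀ b : Fin B, walkersLaw n (barrier m K t (x + 2 * m * (b : ℕ))) =
      ∏ q ∈ J, walkerLaw (barrierEvent K t ((b : ℕ), q)) := by
    intro b
    rw [barrier_eq_biInter, walkersLaw_biInter _ (hinj.mono ?_) (measurableSet_barrierEvent K t),
      Finset.prod_product, Finset.prod_singleton]
    intro p hp
    simp only [Finset.coe_product, Finset.coe_singleton, Set.mem_prod, Set.mem_singleton_iff,
      Finset.coe_range, Set.mem_Iio] at hp ⊢
    exact ⟨hp.1 ▸ b.2, hp.2⟩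
  have hset : (⋂ b ∈ s, barrier (n := n) m K t (x + 2 * m * (b : ℕ))) =
      ⋂ p ∈ (s.map Fin.valEmbedding) ×ˢ J,
        {z | z ((barrierWalker m x p : ℤ) : ZMod n) ∈ barrierEvent K t p} := by
    ext z
    simp only [barrier_eq_biInter, Set.mem_iInter, Finset.mem_product, Finset.mem_singleton,
      Finset.mem_map, Fin.valEmbedding_apply, J]
    constructor
    · rintro h p ⟨⟨b, hb, hbp⟩, hp⟩
      exact h b hb p ⟨hbp.symm, hp⟩
    · rintro h b hb p ⟨hbp, hp⟩
      exact h p ⟨⟨b, hb, hbp.symm⟩, hp⟩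
  rw [hset, walkersLaw_biInter _ (hinj.mono ?_) (measurableSet_barrierEvent K t),
    Finset.prod_product, Finset.prod_map]
  · exact Finset.prod_congr rfl fun b _ => (hval b).symm
  · intro p hp
    simp only [Finset.coe_product, Finset.coe_map, Set.mem_prod, Set.mem_image, Finset.mem_coe,
      Finset.coe_range, Set.mem_Iio, J] at hp ⊢
    obtain ⟨⟨b, -, hb⟩, hp⟩ := hp
    exact ⟨hb ▸ b.2, hp⟩

/-- It is unlikely that there is no barrier among `B` independent candidates. -/
lemma walkersLaw_forall_notMem_barrier_le {n m B : ℕ} (hn : 2 * m * B ≤ n) (hmn : 2 * m ≤ n)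
    {K : ℕ} {t : ℝ≥0}
    {p : ℝ} (hp : p ≤ (∏ j ∈ Finset.range m, walkerLaw.real (staysBelow K j t)) ^ 2) (x : ℤ) :
    walkersLaw n {z | ∀ b < B, z ∉ barrier m K t (x + 2 * m * (b : ℕ))} ≤
      ENNReal.ofReal ((1 - p) ^ B) := by
  have hset : {z : ZMod n → (ℕ → ℝ) × (ℕ → ℤ) | ∀ b < B, z ∉ barrier m K t (x + 2 * m * (b : ℕ))} =
      ⋂ b : Fin B, (barrier m K t (x + 2 * m * ((b : ℕ) : ℤ)))ᶜ := by
    ext z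
    simp only [Set.mem_ofPred_eq, Set.mem_iInter, Set.mem_compl_iff]
    exact ⟨fun h b => h b b.2, fun h b hb => h ⟨b, hb⟩⟩
  have hind := iIndepSet_barrier hn K t x
  rw [hset, iIndep.meas_iInter hind fun b =>
    (MeasurableSpace.measurableSet_generateFrom (Set.mem_singleton _)).compl]
  have hbound : ∀ b : Fin B, walkersLaw n (barrier m K t (x + 2 * m * ((b : ℕ) : ℤ)))ᶜ ≤
      ENNReal.ofReal (1 - p) := by
    intro b
    rw [← ofReal_measureReal, probReal_compl_eq_one_sub (measurableSet_barrier _ _ _ _),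
      measureReal_def, walkersLaw_barrier hmn, ENNReal.toReal_pow, ENNReal.toReal_prod]
    exact ENNReal.ofReal_le_ofReal (sub_le_sub_left hp 1)
  have hp1 : p ≤ 1 := hp.trans (pow_le_one₀ (Finset.prod_nonneg fun _ _ => measureReal_nonneg)
    (Finset.prod_le_one (fun _ _ => measureReal_nonneg) fun _ _ => measureReal_le_one))
  refine (Finset.prod_le_prod' fun b _ => hbound b).trans_eq ?_
  rw [Finset.prod_const, Finset.card_univ, Fintype.card_fin, ENNReal.ofReal_pow (by linarith)]

/-- The probability of a barrier is at least exponentially small in `L`, uniformly in the size `m`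
of the neighbourhood as long as all walkers in it are likely to make at most `L ^ 2` jumps. -/
lemma exp_le_prod_staysBelow {L : ℕ} (hL : 0 < L) {m : ℕ} {t : ℝ≥0}
    (ht : (t : ℝ) ≤ (L : ℝ) ^ 2 / 4) (hm : (m : ℝ) * Real.exp (-((L : ℝ) ^ 2 / 4)) ≤ 1 / 2) :
    Real.exp (-(8 * L)) / 4 ≤
      (∏ j ∈ Finset.range m, walkerLaw.real (staysBelow (L ^ 2) j t)) ^ 2 := by
  set δ := Real.exp (-((L : ℝ) ^ 2 / 4)) with hδ
  have hδ0 : 0 ≤ δ := (Real.exp_pos _).le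
  have hδ1 : δ ≤ 1 := by rw [hδ, Real.exp_le_one_iff]; simp; positivity
  have h1 : 1 / 2 * Real.exp (-(4 * L)) ≤
      ∏ j ∈ Finset.range m, walkerLaw.real (staysBelow (L ^ 2) j t) := by
    calc 1 / 2 * Real.exp (-(4 * L))
        ≤ (1 - δ) ^ m * ∏ j ∈ Finset.range m, survival (L ^ 2) (j : ℤ) := by
          refine mul_le_mul ?_ (exp_le_prod_survival hL m) (Real.exp_pos _).le
            (pow_nonneg (by linarith) _)
          have := one_add_mul_le_pow (a := -δ) (by linarith) m
          rw [← sub_eq_add_neg] at this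
          linarith
      _ = ∏ j ∈ Finset.range m, ((1 - δ) * survival (L ^ 2) (j : ℤ)) := by
          rw [Finset.prod_mul_distrib, Finset.prod_const, Finset.card_range]
      _ ≤ _ := Finset.prod_le_prod
          (fun j _ => mul_nonneg (by linarith) (survival_nonneg _ _))
          fun j _ => le_walkerLaw_staysBelow ht j
  calc Real.exp (-(8 * L)) / 4 = (1 / 2 * Real.exp (-(4 * L))) ^ 2 := by
        rw [mul_pow, ← Real.exp_nat_mul]; ring_nf
    _ ≤ _ := by gcongr

lemma abs_walk_le {s : ℕ → ℤ} (hs : ∀ k, s k = 1 ∨ s k = -1) (k : ℕ) :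
    -(k : ℤ) ≤ walk s k ∧ walk s k ≤ k := by
  induction k with
  | zero => simp
  | succ k ih =>
    rw [walk_succ]; push_cast
    rcases hs k with h | h <;> rw [h] <;> constructor <;> linarith [ih.1, ih.2]

/-- Walkers that start between two barriers stay there, if none of them makes `m` jumps. -/
lemma Typical.confined {n : ℕ} {z : ZMod n → (ℕ → ℝ) × (ℕ → ℤ)} (hz : Typical z) {m K : ℕ}
    {t : ℝ≥0} (hm : ∀ w, (t : ℝ) < jumpTime (z w).1 m) {x y : ℤ}
    (hx : z ∈ barrier m K t x) (hy : z ∈ barrier m K t y) {i : ℤ} (hxi : x < i) (hiy : i ≤ y)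
    {s : ℝ≥0} (hs : s ≤ t) : x < i + displacement (z i) s ∧ i + displacement (z i) s ≤ y := by
  have hcount := (hz.1 i).jumpCount_lt_of_lt_jumpTime hs (hm i)
  have hd := abs_walk_le (hz.2.1 i) (jumpCount (z i).1 s)
  rw [← displacement] at hd
  constructor
  · by_cases h : i - x - 1 < m
    · obtain ⟨j, hj⟩ := Int.eq_ofNat_of_zero_le (by omega : 0 ≤ i - x - 1)
      have h1 := (hx j (by omega)).2
      rw [show x + 1 + (j : ℤ) = i by omega] at h1
      have h2 := Regular.displacement_le_of_mem_staysBelow (z := reflect _) (hz.1 _) h1 hs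
      rw [displacement_reflect] at h2
      omega
    · omega
  · by_cases h : y - i < m
    · obtain ⟨j, hj⟩ := Int.eq_ofNat_of_zero_le (by omega : 0 ≤ y - i)
      have h1 := (hy j (by omega)).1
      rw [show y - (j : ℤ) = i by omega] at h1
      have h2 := (hz.1 _).displacement_le_of_mem_staysBelow h1 hs
      omega
    · omega

/-- Two barriers separate the cycle into two arcs without acquaintances between them. -/
lemma Typical.not_connectedBy {n : ℕ} [NeZero n] {z : ZMod n → (ℕ → ℝ) × (ℕ → ℤ)} (hz : Typical z)
    {m K : ℕ} {t : ℝ≥0} (hm : ∀ w, (t : ℝ) < jumpTime (z w).1 m) {x y : ℤ}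
    (hx : z ∈ barrier m K t x) (hy : z ∈ barrier m K t y) (hxy : x < y) (hyx : y < x + n) :
    ¬ ConnectedBy (paths z) t := by
  intro hc
  have hx' : z ∈ barrier m K t (x + n) := by rwa [barrier_add_card]
  -- Acquaintances do not leave the arc from `x + 1` to `y`.
  have key : ∀ b : ZMod n, Relation.TransGen (MetBy (paths z) t) ((x + 1 : ℤ) : ZMod n) b →
      ∃ i : ℤ, x < i ∧ i ≤ y ∧ (i : ZMod n) = b := by
    have hstep : ∀ a b : ZMod n, (∃ i : ℤ, x < i ∧ i ≤ y ∧ (i : ZMod n) = a) →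
        MetBy (paths z) t a b → ∃ i : ℤ, x < i ∧ i ≤ y ∧ (i : ZMod n) = b := by
      rintro _ b ⟨i, hi1, hi2, rfl⟩ ⟨s, hs, hmeet⟩
      obtain ⟨k, hk1, hk2, rfl⟩ : ∃ k : ℤ, x < k ∧ k ≤ x + n ∧ (k : ZMod n) = b := by
        refine ⟨x + 1 + (b - (x + 1 : ℤ) : ZMod n).val, by omega, ?_, ?_⟩
        · have := ZMod.val_lt (b - (x + 1 : ℤ) : ZMod n)
          omega
        · push_cast; simp
      by_cases hky : k ≤ y
      · exact ⟨k, hk1, hky, rfl⟩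
      exfalso
      have h1 := hz.confined hm hx hy hi1 hi2 hs
      have h2 := hz.confined hm hy hx' (not_le.1 hky) hk2 hs
      have h3 : ((i + displacement (z i) s : ℤ) : ZMod n) =
          ((k + displacement (z k) s : ℤ) : ZMod n) := by
        simpa [paths] using hmeet
      have := intCast_zmod_injOn (by rw [abs_sub_lt_iff]; constructor <;> omega) h3
      omega
    intro b hb
    induction hb with
    | single h => exact hstep _ _ ⟨x + 1, by omega, by omega, rfl⟩ h
    | tail _ h ih => exact hstep _ _ ih h
  obtain ⟨i, hi1, hi2, hi3⟩ := key _ (hc (x + 1 : ℤ) (y + 1 : ℤ))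
  have := intCast_zmod_injOn (by rw [abs_sub_lt_iff]; constructor <;> omega) hi3
  omega

/-- If `2 * B` disjoint neighbourhoods of radius `m` fit into the cycle, then the walkers are
acquainted by a time of order `L ^ 2` only if some walker makes `m` jumps, or there is no barrier
among the first `B` neighbourhoods, or none among the last `B`. -/
lemma walkersLaw_connectedBy_le {n m B L : ℕ} [NeZero n] (hL : 0 < L) (hm0 : 0 < m)
    (hn : 2 * m * (2 * B) ≤ n) (hmn : 2 * m ≤ n)
    {t : ℝ≥0} (ht : (t : ℝ) ≤ (L : ℝ) ^ 2 / 4)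
    (hm : (m : ℝ) * Real.exp (-((L : ℝ) ^ 2 / 4)) ≤ 1 / 2) :
    walkersLaw n {z | ConnectedBy (paths z) t} ≤
      ENNReal.ofReal (n * (Real.exp t * (1 / 2) ^ m) + 2 * (1 - Real.exp (-(8 * L)) / 4) ^ B) := by
  have hp := exp_le_prod_staysBelow hL ht hm
  have hp1 : Real.exp (-(8 * L)) ≤ 1 := by rw [Real.exp_le_one_iff]; simp
  have hB : 2 * m * B ≤ n := le_trans (by nlinarith) hn
  set E : ℤ → Set (ZMod n → (ℕ → ℝ) × (ℕ → ℤ)) := fun x =>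
    {z | ∀ b < B, z ∉ barrier m (L ^ 2) t (x + 2 * m * (b : ℕ))}
  set F : Set (ZMod n → (ℕ → ℝ) × (ℕ → ℤ)) := ⋃ w : ZMod n, {z | jumpTime (z w).1 m ≤ t}
  have hsub : ∀ᵐ z ∂walkersLaw n, z ∈ {z | ConnectedBy (paths z) t} →
      z ∈ F ∪ (E 0 ∪ E (2 * m * B)) := by
    filter_upwards [ae_typical] with z hz hc
    by_contra h
    simp only [Set.mem_union, not_or, F, E, Set.mem_iUnion, Set.mem_ofPred_eq] at h
    push Not at h
    obtain ⟨hF, ⟨b, hb, hbz⟩, b', hb', hbz'⟩ := h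
    have h1 : (2 : ℤ) * m * (b + 1) ≤ 2 * m * B := by
      have : (b : ℤ) + 1 ≤ B := by exact_mod_cast hb
      gcongr
    have h2 : (2 : ℤ) * m * (b' + 1) ≤ 2 * m * B := by
      have : (b' : ℤ) + 1 ≤ B := by exact_mod_cast hb'
      gcongr
    have h3 : (2 : ℤ) * m * (2 * B) ≤ n := by exact_mod_cast hn
    have h4 : (0 : ℤ) < m := by exact_mod_cast hm0
    have h5 : (0 : ℤ) ≤ 2 * m * b := by positivity
    have h6 : (0 : ℤ) ≤ 2 * m * b' := by positivity
    exact hz.not_connectedBy hF hbz hbz' (by linarith) (by linarith) hc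
  have hF : walkersLaw n F ≤ ENNReal.ofReal (n * (Real.exp t * (1 / 2) ^ m)) := by
    have hw : ∀ w : ZMod n, walkersLaw n {z | jumpTime (z w).1 m ≤ t} ≤
        ENNReal.ofReal (Real.exp t * (1 / 2) ^ m) := by
      intro w
      have h3 : MeasurePreserving (Prod.fst : (ℕ → ℝ) × (ℕ → ℤ) → ℕ → ℝ) walkerLaw holdLaw :=
        measurePreserving_fst
      have h4 : MeasurableSet {h : ℕ → ℝ | jumpTime h m ≤ t} :=
        measurableSet_le (by fun_prop) (by fun_prop)
      exact ((h3.comp (measurePreserving_eval_walkersLaw w)).measure_preimage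
        h4.nullMeasurableSet).trans_le (holdLaw_jumpTime_le m t)
    refine (measure_iUnion_fintype_le _ _).trans ((Finset.sum_le_sum fun w _ => hw w).trans_eq ?_)
    rw [Finset.sum_const, Finset.card_univ, ZMod.card, nsmul_eq_mul,
      ENNReal.ofReal_mul (p := (n : ℝ)) (by positivity), ENNReal.ofReal_natCast]
  have hE : ∀ x, walkersLaw n (E x) ≤ ENNReal.ofReal ((1 - Real.exp (-(8 * L)) / 4) ^ B) :=
    fun x => walkersLaw_forall_notMem_barrier_le hB hmn hp x
  have hpos : 0 ≤ (1 - Real.exp (-(8 * L)) / 4) ^ B := pow_nonneg (by linarith) _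
  calc walkersLaw n {z | ConnectedBy (paths z) t}
      ≤ walkersLaw n (F ∪ (E 0 ∪ E (2 * m * B))) := measure_mono_ae hsub
    _ ≤ walkersLaw n F + (walkersLaw n (E 0) + walkersLaw n (E (2 * m * B))) :=
      (measure_union_le _ _).trans (add_le_add_right (measure_union_le _ _) _)
    _ ≤ _ := by
      rw [ENNReal.ofReal_add (by positivity) (by linarith),
        two_mul ((1 - Real.exp (-(8 * (L : ℝ))) / 4) ^ B), ENNReal.ofReal_add hpos hpos]
      exact add_le_add hF (add_le_add (hE _) (hE _))

/-- With positive probability nobody moves, and then nobody meets. -/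
lemma walkersLaw_connectedBy_le_one_sub {n : ℕ} (hn : 2 ≤ n) (t : ℝ≥0) :
    walkersLaw n {z | ConnectedBy (paths z) t} ≤ ENNReal.ofReal (1 - Real.exp (-t) ^ n) := by
  have : NeZero n := ⟨by omega⟩
  set A : Set ((ℕ → ℝ) × (ℕ → ℤ)) := Prod.fst ⁻¹' {h : ℕ → ℝ | (t : ℝ) < h 0}
  have hA : MeasurableSet A :=
    measurable_fst (measurableSet_lt measurable_const (measurable_pi_apply 0))
  have hAp : walkerLaw.real A = Real.exp (-t) := by
    have h1 : MeasurePreserving (Prod.fst : (ℕ → ℝ) × (ℕ → ℤ) → ℕ → ℝ) walkerLaw holdLaw :=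
      measurePreserving_fst
    have h2 : MeasurePreserving (fun h : ℕ → ℝ => h 0) holdLaw (expMeasure 1) :=
      measurePreserving_eval_infinitePi (fun _ : ℕ => expMeasure 1) 0
    have h3 : A = ((fun h : ℕ → ℝ => h 0) ∘ Prod.fst) ⁻¹' (Set.Iic (t : ℝ))ᶜ := by
      ext z; simp [A]
    rw [h3, (h2.comp h1).measureReal_preimage measurableSet_Iic.compl.nullMeasurableSet,
      probReal_compl_eq_one_sub measurableSet_Iic, ← cdf_eq_real, cdf_expMeasure_eq one_pos]
    simp
  set G : Set (ZMod n → (ℕ → ℝ) × (ℕ → ℤ)) :=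
    ⋂ w ∈ (Finset.univ : Finset (ZMod n)), {z | z w ∈ A}
  have hG : (walkersLaw n).real G = Real.exp (-t) ^ n := by
    have h := walkersLaw_biInter (n := n) (f := id) Finset.univ Function.injective_id.injOn
      fun _ => hA
    simp only [id] at h
    rw [measureReal_def, h, Finset.prod_const, ENNReal.toReal_pow, ← measureReal_def, hAp,
      Finset.card_univ, ZMod.card]
  have hGm : MeasurableSet G :=
    Finset.measurableSet_biInter _ fun w _ => (measurable_pi_apply w) hA
  have hsub : ∀ᵐ z ∂walkersLaw n, z ∈ {z | ConnectedBy (paths z) t} → z ∈ Gᶜ := by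
    filter_upwards [ae_typical] with z hz hc hzG
    have hd : ∀ w, ∀ s ≤ t, displacement (z w) s = 0 := by
      intro w s hs
      have h1 : (t : ℝ) < jumpTime (z w).1 1 := by
        rw [jumpTime_succ, jumpTime_zero, zero_add]
        exact Set.mem_iInter₂.1 hzG w (Finset.mem_univ _)
      have h2 := (hz.1 w).jumpCount_lt_of_lt_jumpTime hs h1
      rw [displacement, Nat.lt_one_iff.1 h2, walk_zero]
    have key : ∀ b : ZMod n, Relation.TransGen (MetBy (paths z) t) 0 b → b = 0 := by
      have hstep : ∀ a b : ZMod n, MetBy (paths z) t a b → a = b := by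
        rintro a b ⟨s, hs, h⟩
        simpa [paths, hd _ s hs] using h
      intro b hb
      induction hb with
      | single h => exact (hstep _ _ h).symm
      | tail _ h ih => exact (hstep _ _ h).symm.trans ih
    have h1 := key 1 (hc 0 1)
    have : Fact (1 < n) := ⟨by omega⟩
    exact one_ne_zero h1
  refine (measure_mono_ae hsub).trans ?_
  rw [← hG, ← probReal_compl_eq_one_sub hGm, ofReal_measureReal]
  exact le_rfl

/-! ### Choice of the parameters -/

lemma mul_exp_mul_half_pow_le {x u l t : ℝ} {m : ℕ} (hexpl : Real.exp l = x) (hu64 : 64 ≤ u)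
    (hlu : l ≤ u) (ht : t ≤ u) (hm : u ^ 4 < (m : ℝ) + 1) :
    x * (Real.exp t * (1 / 2) ^ m) ≤ Real.exp (-u ^ 2 - 1) := by
  calc x * (Real.exp t * (1 / 2) ^ m)
      ≤ Real.exp l * (Real.exp t * Real.exp (-(m / 2))) := by
        rw [hexpl]
        have : 0 ≤ x := hexpl ▸ (Real.exp_pos l).le
        gcongr
        exact half_pow_le_exp m
    _ = Real.exp (l + (t + -(m / 2))) := by rw [Real.exp_add, Real.exp_add]
    _ ≤ _ := by
      apply Real.exp_le_exp.2
      have h1 : 64 ^ 2 ≤ u ^ 2 := pow_le_pow_left₀ (by norm_num) hu64 2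
      have h2 : 64 ^ 2 * u ^ 2 ≤ u ^ 4 := by nlinarith
      nlinarith

lemma one_sub_exp_pow_le {u l : ℝ} {L B : ℕ} (hu0 : 64 * Real.exp 8 ≤ u)
    (hulog : Real.exp (l / 8) = u) (hL2 : (L : ℝ) ≤ l / 64 + 1) (hB2 : u ^ 4 / 8 ≤ (B : ℝ)) :
    (1 - Real.exp (-(8 * (L : ℝ))) / 4) ^ B ≤ Real.exp (-u ^ 2 - 3) := by
  have hu64 : 64 ≤ u := by linarith [Real.add_one_le_exp (8 : ℝ)]
  have hp1 : Real.exp (-(8 * (L : ℝ))) ≤ 1 := by rw [Real.exp_le_one_iff]; simp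
  have h1 : Real.exp (-8) / u ≤ Real.exp (-(8 * (L : ℝ))) := by
    rw [← hulog, ← Real.exp_sub]
    apply Real.exp_le_exp.2
    linarith
  have h2 : u ^ 2 + 3 ≤ Real.exp (-(8 * (L : ℝ))) / 4 * B := by
    calc u ^ 2 + 3 ≤ 2 * u ^ 2 := by nlinarith
      _ = Real.exp (-8) * (64 * Real.exp 8) * u ^ 2 / 32 := by
        have : Real.exp (-8) * Real.exp 8 = 1 := by rw [← Real.exp_add]; simp
        linear_combination (-2 * u ^ 2) * this
      _ ≤ Real.exp (-8) * u * u ^ 2 / 32 := by gcongr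
      _ = Real.exp (-8) / u / 4 * (u ^ 4 / 8) := by
        have : u ≠ 0 := by linarith
        field_simp; norm_num
      _ ≤ _ := by gcongr
  calc (1 - Real.exp (-(8 * (L : ℝ))) / 4) ^ B
      ≤ Real.exp (-(Real.exp (-(8 * (L : ℝ))) / 4)) ^ B := by
        refine pow_le_pow_left₀ (by linarith) ?_ _
        linarith [Real.add_one_le_exp (-(Real.exp (-(8 * (L : ℝ))) / 4))]
    _ = Real.exp (B * -(Real.exp (-(8 * (L : ℝ))) / 4)) := by rw [← Real.exp_nat_mul]
    _ ≤ _ := by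
      apply Real.exp_le_exp.2
      linarith

/-- The bound `walkersLaw_connectedBy_le` with `L` about `log n / 64`, `m` about `√n` and `B` about
`√n / 4`; then the time is at most `L ^ 2 / 4`. In terms of `u = n ^ (1 / 8)`, the probability of a
barrier is at least of order `1 / u`, and the number of candidates is of order `u ^ 4`. -/
lemma walkersLaw_connectedBy_le_of_large {n : ℕ} {u : ℝ} (hu : u = (n : ℝ) ^ (1 / 8 : ℝ))
    (hu0 : 64 * Real.exp 8 ≤ u) (hlog : 16384 ≤ Real.log n) (hlogu : Real.log n ^ 2 ≤ u) :
    walkersLaw n {z | ConnectedBy (paths z) (1 / 16384 * Real.log n ^ 2).toNNReal} ≤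
      ENNReal.ofReal (Real.exp (-u ^ 2)) := by
  have hn0 : 0 < n := by
    rcases Nat.eq_zero_or_pos n with rfl | h
    · norm_num at hlog
    · exact h
  have : NeZero n := ⟨hn0.ne'⟩
  have hnR : (0 : ℝ) < n := by exact_mod_cast hn0
  have hu64 : 64 ≤ u := by linarith [Real.add_one_le_exp (8 : ℝ)]
  have hu8 : u ^ 8 = n := by
    rw [hu, ← Real.rpow_natCast, ← Real.rpow_mul hnR.le]; norm_num
  have hulog : Real.exp (Real.log n / 8) = u := by
    rw [hu, Real.rpow_def_of_pos hnR]; congr 1; ring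
  set l := Real.log n
  have hexpl : Real.exp l = n := Real.exp_log hnR
  set t : ℝ≥0 := (1 / 16384 * l ^ 2).toNNReal with ht
  have htR : (t : ℝ) = 1 / 16384 * l ^ 2 := Real.coe_toNNReal _ (by positivity)
  set L := ⌈l / 64⌉₊ with hLdef
  have hL0 : 0 < L := Nat.ceil_pos.2 (by linarith)
  have hL1 : l / 64 ≤ L := Nat.le_ceil _
  have hL2 : (L : ℝ) ≤ l / 64 + 1 := (Nat.ceil_lt_add_one (by linarith)).le
  have hLsq : l ^ 2 / 16384 ≤ (L : ℝ) ^ 2 / 4 := by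
    have h1 : (l / 64) ^ 2 ≤ (L : ℝ) ^ 2 := pow_le_pow_left₀ (by linarith) hL1 2
    linarith
  set m := Nat.sqrt n
  have hm1 : m * m ≤ n := Nat.sqrt_le n
  have hm1R : (m : ℝ) ^ 2 ≤ n := by exact_mod_cast Nat.sqrt_le' n
  have hm2 : u ^ 4 < (m : ℝ) + 1 := by
    have h1 : (n : ℝ) < ((m : ℝ) + 1) ^ 2 := by exact_mod_cast Nat.lt_succ_sqrt' n
    refine lt_of_pow_lt_pow_left₀ 2 (by positivity) ?_
    calc (u ^ 4) ^ 2 = n := by rw [← pow_mul, hu8]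
      _ < _ := h1
  have hu4 : 64 ^ 3 * u ≤ u ^ 4 := by
    have : (64 : ℝ) ^ 3 ≤ u ^ 3 := pow_le_pow_left₀ (by norm_num) hu64 3
    nlinarith
  have hmbig : 4 ≤ m := by
    have : (4 : ℝ) ≤ m := by linarith
    exact_mod_cast this
  set B := m / 4 with hBdef
  have hB1 : 4 * B ≤ m := Nat.mul_div_le m 4
  have hB2 : u ^ 4 / 8 ≤ (B : ℝ) := by
    have h1 : m < 4 * (B + 1) := by omega
    have h2 : (m : ℝ) < 4 * (B + 1) := by exact_mod_cast h1
    linarith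
  have hmexp : (m : ℝ) * Real.exp (-((L : ℝ) ^ 2 / 4)) ≤ 1 / 2 := by
    have h1 : (m : ℝ) ≤ Real.exp (l / 2) := by
      refine le_of_sq_le_sq ?_ (Real.exp_pos _).le
      rw [← Real.exp_nat_mul]
      push_cast
      rw [mul_div_cancel₀ _ two_ne_zero, hexpl]
      exact hm1R
    have h2 : Real.exp (-((L : ℝ) ^ 2 / 4)) ≤ Real.exp (-l) := by
      apply Real.exp_le_exp.2
      nlinarith
    calc (m : ℝ) * Real.exp (-((L : ℝ) ^ 2 / 4)) ≤ Real.exp (l / 2) * Real.exp (-l) := by gcongr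
      _ = Real.exp (-(l / 2)) := by rw [← Real.exp_add]; congr 1; ring
      _ ≤ 1 / 2 := by
        rw [Real.exp_neg, inv_le_comm₀ (Real.exp_pos _) (by norm_num)]
        linarith [Real.add_one_le_exp (l / 2)]
  have hBn : 2 * m * (2 * B) ≤ n := le_trans (by nlinarith) hm1
  refine (walkersLaw_connectedBy_le hL0 (by omega) hBn (by nlinarith)
    (by rw [htR]; linarith) hmexp).trans (ENNReal.ofReal_le_ofReal ?_)
  have hl_le : l ≤ u := by nlinarith
  have hterm1 : (n : ℝ) * (Real.exp t * (1 / 2) ^ m) ≤ Real.exp (-u ^ 2 - 1) :=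
    mul_exp_mul_half_pow_le hexpl hu64 hl_le (by rw [htR]; linarith [sq_nonneg l]) hm2
  have hterm2 := one_sub_exp_pow_le hu0 hulog hL2 hB2
  have e1 : Real.exp (-u ^ 2 - 1) ≤ Real.exp (-u ^ 2) / 2 := by
    rw [Real.exp_sub]
    gcongr
    linarith [Real.exp_one_gt_d9]
  have e3 : Real.exp (-u ^ 2 - 3) ≤ Real.exp (-u ^ 2) / 4 := by
    rw [Real.exp_sub]
    gcongr
    linarith [Real.add_one_le_exp (3 : ℝ)]
  linarith

lemma exists_forall_walkersLaw_connectedBy_le : ∃ N : ℕ, ∀ n ≥ N,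
    walkersLaw n {z | ConnectedBy (paths z) (1 / 16384 * Real.log n ^ 2).toNNReal} ≤
      ENNReal.ofReal (Real.exp (-(n : ℝ) ^ (1 / 4 : ℝ))) := by
  have h1 : ∀ᶠ x : ℝ in Filter.atTop, 64 * Real.exp 8 ≤ x ^ (1 / 8 : ℝ) :=
    (tendsto_rpow_atTop (by norm_num)).eventually_ge_atTop _
  have h2 : ∀ᶠ x : ℝ in Filter.atTop, 16384 ≤ Real.log x :=
    Real.tendsto_log_atTop.eventually_ge_atTop _
  have h3 : ∀ᶠ x : ℝ in Filter.atTop, Real.log x ^ 2 ≤ x ^ (1 / 8 : ℝ) := by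
    filter_upwards [(isLittleO_log_rpow_atTop (r := 1 / 16) (by norm_num)).bound one_pos,
      Filter.eventually_gt_atTop 0] with x hx hx0
    rw [one_mul, Real.norm_eq_abs, Real.norm_eq_abs, abs_of_pos (Real.rpow_pos_of_pos hx0 _)] at hx
    calc Real.log x ^ 2 = |Real.log x| ^ 2 := (sq_abs _).symm
      _ ≤ (x ^ (1 / 16 : ℝ)) ^ 2 := by gcongr
      _ = x ^ (1 / 8 : ℝ) := by rw [← Real.rpow_natCast, ← Real.rpow_mul hx0.le]; norm_num
  obtain ⟨N, hN⟩ := Filter.eventually_atTop.1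
    (tendsto_natCast_atTop_atTop.eventually (h1.and (h2.and h3)))
  refine ⟨N, fun n hn => ?_⟩
  obtain ⟨hn1, hn2, hn3⟩ := hN n hn
  refine (walkersLaw_connectedBy_le_of_large rfl hn1 hn2 hn3).trans_eq ?_
  rw [← Real.rpow_natCast, ← Real.rpow_mul (by positivity)]
  norm_num

/-- A constant that works for every `n`, obtained from `walkersLaw_connectedBy_le_one_sub` when `n`
is small. -/
lemma exists_walkersLaw_connectedBy_le : ∃ c : ℝ, 0 < c ∧ ∀ n ≥ 3,
    walkersLaw n {z | ConnectedBy (paths z) (1 / 16384 * Real.log n ^ 2).toNNReal} ≤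
      ENNReal.ofReal (Real.exp (-c * (n : ℝ) ^ (1 / 4 : ℝ))) := by
  obtain ⟨N, hN⟩ := exists_forall_walkersLaw_connectedBy_le
  -- The second term of the minimum takes care of the finitely many `n < N`.
  set δ := Real.exp (-(N : ℝ) ^ 3)
  have hδ : 0 < δ := Real.exp_pos _
  refine ⟨min 1 (δ / (N + 1)), by positivity, fun n hn => ?_⟩
  have hn1 : (1 : ℝ) ≤ n := by exact_mod_cast (by omega : 1 ≤ n)
  have hpow : 0 ≤ (n : ℝ) ^ (1 / 4 : ℝ) := by positivity
  rcases le_or_gt N n with h | h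
  · refine (hN n h).trans (ENNReal.ofReal_le_ofReal (Real.exp_le_exp.2 ?_))
    nlinarith [min_le_left 1 (δ / (N + 1))]
  · refine (walkersLaw_connectedBy_le_one_sub (by omega) _).trans (ENNReal.ofReal_le_ofReal ?_)
    have hnN : (n : ℝ) ≤ N := by exact_mod_cast h.le
    have h1 : min 1 (δ / (N + 1)) * (n : ℝ) ^ (1 / 4 : ℝ) ≤ δ := by
      have h2 : (n : ℝ) ^ (1 / 4 : ℝ) ≤ N + 1 := by
        calc (n : ℝ) ^ (1 / 4 : ℝ) ≤ (n : ℝ) ^ (1 : ℝ) :=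
              Real.rpow_le_rpow_of_exponent_le hn1 (by norm_num)
          _ ≤ N + 1 := by rw [Real.rpow_one]; linarith
      calc min 1 (δ / (N + 1)) * (n : ℝ) ^ (1 / 4 : ℝ) ≤ δ / (N + 1) * (N + 1) := by
            gcongr
            exact min_le_right _ _
        _ = δ := div_mul_cancel₀ _ (by positivity)
    have h2 : δ ≤ Real.exp (-((1 / 16384 * Real.log n ^ 2).toNNReal : ℝ)) ^ n := by
      rw [Real.coe_toNNReal _ (by positivity), ← Real.exp_nat_mul]
      apply Real.exp_le_exp.2
      have h3 : Real.log n ≤ n := (Real.log_le_sub_one_of_pos (by linarith)).trans (by linarith)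
      have h4 : 0 ≤ Real.log n := Real.log_nonneg hn1
      have h5 : Real.log n ^ 2 ≤ (n : ℝ) ^ 2 := pow_le_pow_left₀ h4 h3 2
      have h6 : (n : ℝ) ^ 3 ≤ (N : ℝ) ^ 3 := pow_le_pow_left₀ (by linarith) hnN 3
      have h7 : (n : ℝ) * (1 / 16384 * Real.log n ^ 2) ≤ n * (n : ℝ) ^ 2 := by
        gcongr
        linarith [sq_nonneg (Real.log n)]
      nlinarith
    have h3 := Real.add_one_le_exp (-min 1 (δ / (N + 1)) * (n : ℝ) ^ (1 / 4 : ℝ))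
    linarith

end SocialNetwork

theorem theorem3 :
    ∃ c₁ c₂ α C₁ C₂ : ℝ, 0 < c₁ ∧ 0 < c₂ ∧ 0 < α ∧ 0 < C₁ ∧ 0 < C₂ ∧
      ∀ (n : ℕ), 3 ≤ n →
      ∀ (Ω : Type*) [MeasurableSpace Ω] (μ : Measure Ω) [IsProbabilityMeasure μ]
        (hold : ZMod n → ℕ → Ω → ℝ) (step : ZMod n → ℕ → Ω → ℤ),
        SocialNetwork.IsWalkInput μ n hold step →
          μ {ω | SocialNetwork.cycleSC hold step ω > ENNReal.ofReal (C₁ * Real.log n ^ 2)}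
              ≤ ENNReal.ofReal (C₂ / n) ∧
          μ {ω | SocialNetwork.cycleSC hold step ω < ENNReal.ofReal (c₁ * Real.log n ^ 2)}
              ≤ ENNReal.ofReal (Real.exp (-c₂ * (n : ℝ) ^ α)) := by
  obtain ⟨c₂, hc₂, hlower⟩ := SocialNetwork.exists_walkersLaw_connectedBy_le
  refine ⟨1 / 16384, c₂, 1 / 4, 20810, 41616, by norm_num, hc₂, by norm_num, by norm_num,
    by norm_num, fun n hn Ω _ μ _ hold step h => ?_⟩
  -- `trajectory hold step ω` is by definition `paths` of the input of all walkers at `ω`.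
  have hlaw := h.hasLaw_walkersLaw
  constructor
  · refine le_trans ?_ (SocialNetwork.walkersLaw_not_connectedBy_log_sq_le hn)
    rw [← hlaw.map_eq]
    refine le_trans (measure_mono ?_) (Measure.le_map_apply hlaw.aemeasurable _)
    exact fun ω hω => SocialNetwork.not_connectedBy_of_lt hω
  · refine le_trans ?_ (hlower n hn)
    rw [← hlaw.map_eq]
    refine le_trans (measure_mono ?_) (Measure.le_map_apply hlaw.aemeasurable _)
    exact fun ω hω => SocialNetwork.connectedBy_of_lt hω
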